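/- **Theorem.** Let $(\mathsf Z,d)$ be a complete separable metric space with its Borel $\sigma$-field and let $Q$ be a Markov kernel on $\mathsf Z$ which has a unique invariant probability measure $\pi$ and is uniformly geometrically ergodic with mixing time $\tau$: there is an integer $\tau\ge 1$ such that, for all $n\in\mathbb N$ and $z\in\mathsf Z$, $$\tfrac12\,\|Q^n(z,\cdot)-\pi\|_{\mathrm{TV}}\le (1/4)^{\lfloor n/\tau\rfloor},$$ where $\|\mu-\nu\|_{\mathrm{TV}}$ is the total mass of the total variation measure $|\mu-\nu|$. For a probability measure $\xi$ on $\mathsf Z$ let $\mathrm E_\xi$ be the expectation for the Markov chain $(Z_k)_{k\ge0}$ with kernel $Q$ and initial distribution $\xi$. Let $f:\mathsf Z\to\mathbb R$ be measurable with $\|f\|_\infty=\sup_z|f(z)|\le 1$, and put $\bar f=f-\pi(f)$, $\bar S_n=\sum_{i=0}^{n-1}\bar f(Z_i)$ and $$\sigma_\pi^2(f)=\pi(\bar f^2)+2\sum_{\ell=1}^\infty\pi(\bar f\,Q^\ell\bar f).$$ Then this series converges absolutely, $\sigma_\pi^2(f)\ge0$, and for every real $p\ge2$ and every $n\in\mathbb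 N$ $$\mathrm E_\pi^{1/p}\big[|\bar S_n|^p\big]\le C_{\mathrm{Rm},1}\sqrt2\,p^{1/2}n^{1/2}\sigma_\pi(f)+D_1\,n^{1/4}\tau^{3/4}\,p\log_2(2p)+D_2\,\tau\,p\log_2(2p),$$ where $C_{\mathrm{Rm},1}=60e$, $C_{\mathrm{Rm},2}=60$, $D_1=\frac{16}{3}\big(\frac{19}{3}\big)^{1/2}C_{\mathrm{Rm},1}$ and $D_2=\frac{64}{3}\big(C_{\mathrm{Rm},2}^{1/2}C_{\mathrm{Rm},1}^2+C_{\mathrm{Rm},2}\big)$. Moreover, for every probability measure $\xi$ on $\mathsf Z$, $$\mathrm E_\xi^{1/p}\big[|\bar S_n|^p\big]\le \mathrm E_\pi^{1/p}\big[|\bar S_n|^p\big]+2D_2\,\tau\,p\log_2(2p).$$ -/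

import Mathlib

open MeasureTheory ProbabilityTheory

noncomputable section

namespace MarkovRosenthal

variable {Z : Type*} [MeasurableSpace Z]

instance isMarkovKernel_pow (Q : Kernel Z Z) [IsMarkovKernel Q] (n : ℕ) :
    IsMarkovKernel (Q ^ n) := by
  induction n with
  | zero =>
    rw [pow_zero]
    exact inferInstanceAs (IsMarkovKernel Kernel.id)
  | succ n ih =>
    rw [pow_succ]
    exact inferInstanceAs (IsMarkovKernel ((Q ^ n) ∘ₖ Q))

/-- The total variation norm `‖μ - ν‖_TV` of the signed measure `μ - ν`, i.e. the total mass of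
its total variation `|μ - ν|` (it ranges over `[0, 2]` for probability measures). -/
def tvNorm (μ ν : Measure Z) [IsFiniteMeasure μ] [IsFiniteMeasure ν] : ℝ :=
  ((μ.toSignedMeasure - ν.toSignedMeasure).totalVariation Set.univ).toReal

/-- `π` is the unique invariant probability measure of the Markov kernel `Q`, and `Q` is uniformly
geometrically ergodic with mixing time `τ ≥ 1`:
`(1/2) ‖Q^n(z, ·) - π‖_TV ≤ (1/4) ^ ⌊n / τ⌋` for all `n` and `z`.
The quotient `n / τ` is the floor division of natural numbers. -/
structure IsUniformlyGeometricallyErgodic (Q : Kernel Z Z) [IsMarkovKernel Q]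
    (π : Measure Z) [IsProbabilityMeasure π] (τ : ℕ) : Prop where
  invariant : Kernel.Invariant Q π
  unique : ∀ ν : Measure Z, IsProbabilityMeasure ν → Kernel.Invariant Q ν → ν = π
  mixingTime_pos : 0 < τ
  tv_le : ∀ (n : ℕ) (z : Z), (1 / 2 : ℝ) * tvNorm ((Q ^ n) z) π ≤ (1 / 4 : ℝ) ^ (n / τ)

/-- The law `P_ξ` on `Z^ℕ` of the Markov chain with kernel `Q` and initial distribution `ξ`;
the chain is the coordinate process `ω ↦ ω i`. -/
def chainLaw (Q : Kernel Z Z) [IsMarkovKernel Q] (ξ : Measure Z) : Measure (ℕ → Z) :=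
  Kernel.trajMeasure (X := fun _ => Z) ξ
    (fun n => Q.comap (fun h : (i : Finset.Iic n) → Z => h ⟨n, Finset.mem_Iic.2 le_rfl⟩)
      (measurable_pi_apply _))

/-- The centered function `f - π(f)`. -/
def centered (π : Measure Z) (f : Z → ℝ) (z : Z) : ℝ :=
  f z - ∫ x, f x ∂π

/-- The centered sum `∑_{i=0}^{n-1} (f(Z_i) - π(f))` along a trajectory `ω`. -/
def centeredSum (π : Measure Z) (f : Z → ℝ) (n : ℕ) (ω : ℕ → Z) : ℝ :=
  ∑ i ∈ Finset.range n, centered π f (ω i)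

/-- `E_ξ^{1/p}[|∑_{i=0}^{n-1} (f(Z_i) - π(f))|^p]`. -/
def momentNorm (Q : Kernel Z Z) [IsMarkovKernel Q] (ξ π : Measure Z) (f : Z → ℝ)
    (n : ℕ) (p : ℝ) : ℝ :=
  (∫ ω, |centeredSum π f n ω| ^ p ∂(chainLaw Q ξ)) ^ (1 / p)

/-- The autocovariance `π(g Q^ℓ g)` of the centered function `g = f - π(f)`. -/
def autocov (Q : Kernel Z Z) (π : Measure Z) (f : Z → ℝ) (l : ℕ) : ℝ :=
  ∫ z, centered π f z * (∫ x, centered π f x ∂((Q ^ l) z)) ∂π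

/-- The asymptotic variance `σ_π²(f) = π(g²) + 2 ∑_{ℓ ≥ 1} π(g Q^ℓ g)`, where `g = f - π(f)`. -/
def asymptoticVariance (Q : Kernel Z Z) (π : Measure Z) (f : Z → ℝ) : ℝ :=
  (∫ z, centered π f z ^ 2 ∂π) + 2 * ∑' l : ℕ, autocov Q π f (l + 1)

/-- `σ_π(f)`, the square root of the asymptotic variance. -/
def asymptoticStd (Q : Kernel Z Z) (π : Measure Z) (f : Z → ℝ) : ℝ :=
  Real.sqrt (asymptoticVariance Q π f)

/-- The constant `C_{Rm,1} = 60 e`. -/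
def CRm1 : ℝ := 60 * Real.exp 1

/-- The constant `C_{Rm,2} = 60`. -/
def CRm2 : ℝ := 60

/-- The constant `D₁ = (16/3) (19/3)^{1/2} C_{Rm,1}`. -/
def D1 : ℝ := 16 / 3 * Real.sqrt (19 / 3) * CRm1

/-- The constant `D₂ = (64/3) (C_{Rm,2}^{1/2} C_{Rm,1}² + C_{Rm,2})`. -/
def D2 : ℝ := 64 / 3 * (Real.sqrt CRm2 * CRm1 ^ 2 + CRm2)

end MarkovRosenthal

end

/-! Let f̄ be the centered function and g = Σ_k Q^k f̄, which mixing bounds by (8/3)τ. The Poisson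
equation g − Qg = f̄ turns S̄_n into a martingale up to boundary terms, and the stationary variance
of one martingale difference is σ² (`asymptoticVariance_eq`); in particular σ² ≥ 0.

Exponential moments are bounded directly, without a Rosenthal inequality for martingales
(`integral_exp_le`). Over a block of τ steps the martingale moves by at most 8τ, and its conditional
variance H(Z_k) fluctuates around τσ². A second Poisson equation u − Q^τ u = 2(H − τσ²) removes the
fluctuation: the mean of exp(θ(S̄ + g) + θ²u) grows per block by at most exp(2θ²τσ² + O(θ⁴τ⁴)). So E
exp(θS̄_n) ≤ exp(2nθ²σ² + 10⁶nτ³θ⁴ + 2) when 40τ|θ| ≤ 1, for every initial law. Optimising θ gives a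
p-th moment bound of order √(pn)σ + p^{3/4}n^{1/4}τ^{3/4} + pτ (`momentNorm_le`), and the stated
constants leave room.

Changing the initial law must keep the factor 1 before the stationary norm, so it needs another
argument: a coupling carried out on measures (`lintegral_valueFn_upperPow_le`). After 2τ steps two
laws of equal mass share all but a quarter of it, while each sum has moved by at most 4τ. The common
part continues identically and the excess parts are treated recursively. A discrepancy of order jτ
thus carries mass of order 4^{-j}, and its L^p norm is of order τp. -/

namespace MarkovRosenthal

/-! ### Bounded functions, kernels as operators, the Markov property and mixing -/

section

/-- Measurable real functions that are bounded. -/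
def BddMeas {X : Type*} (m : MeasurableSpace X) (φ : X → ℝ) : Prop :=
  Measurable[m] φ ∧ ∃ C, ∀ x, |φ x| ≤ C

namespace BddMeas

variable {X Y : Type*} {m : MeasurableSpace X} {φ ψ : X → ℝ}

lemma of_le {C : ℝ} (h : Measurable[m] φ) (hC : ∀ x, |φ x| ≤ C) : BddMeas m φ := ⟨h, C, hC⟩

lemma mono {m' : MeasurableSpace X} (hm : m ≤ m') (h : BddMeas m φ) : BddMeas m' φ :=
  ⟨h.1.mono hm le_rfl, h.2⟩

lemma const (c : ℝ) : BddMeas m (fun _ => c) := ⟨measurable_const, |c|, fun _ => le_rfl⟩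

lemma add (h : BddMeas m φ) (h' : BddMeas m ψ) : BddMeas m (fun x => φ x + ψ x) := by
  obtain ⟨hm, C, hC⟩ := h
  obtain ⟨hm', C', hC'⟩ := h'
  exact ⟨hm.add hm', C + C', fun x => (abs_add_le _ _).trans (add_le_add (hC x) (hC' x))⟩

lemma neg (h : BddMeas m φ) : BddMeas m (fun x => -φ x) := by
  obtain ⟨hm, C, hC⟩ := h
  exact ⟨hm.neg, C, fun x => by rw [abs_neg]; exact hC x⟩

lemma sub (h : BddMeas m φ) (h' : BddMeas m ψ) : BddMeas m (fun x => φ x - ψ x) := by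
  simpa only [sub_eq_add_neg] using h.add h'.neg

lemma mul (h : BddMeas m φ) (h' : BddMeas m ψ) : BddMeas m (fun x => φ x * ψ x) := by
  obtain ⟨hm, C, hC⟩ := h
  obtain ⟨hm', C', hC'⟩ := h'
  refine ⟨hm.mul hm', C * C', fun x => ?_⟩
  rw [abs_mul]
  exact mul_le_mul (hC x) (hC' x) (abs_nonneg _) ((abs_nonneg _).trans (hC x))

lemma const_mul (c : ℝ) (h : BddMeas m φ) : BddMeas m (fun x => c * φ x) := (const c).mul h

lemma sq (h : BddMeas m φ) : BddMeas m (fun x => φ x ^ 2) := by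
  simpa only [pow_two] using h.mul h

lemma exp (h : BddMeas m φ) : BddMeas m (fun x => Real.exp (φ x)) := by
  obtain ⟨hm, C, hC⟩ := h
  refine ⟨Real.measurable_exp.comp hm, Real.exp C, fun x => ?_⟩
  rw [abs_of_pos (Real.exp_pos _)]
  exact Real.exp_le_exp.2 ((le_abs_self _).trans (hC x))

lemma sum {ι : Type*} (s : Finset ι) {φ : ι → X → ℝ} (h : ∀ i ∈ s, BddMeas m (φ i)) :
    BddMeas m (fun x => ∑ i ∈ s, φ i x) := by
  classical
  induction s using Finset.induction_on with
  | empty => simpa using const (m := m) 0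
  | insert a s ha ih =>
    simp only [Finset.sum_insert ha]
    exact (h a (Finset.mem_insert_self a s)).add
      (ih fun i hi => h i (Finset.mem_insert_of_mem hi))

lemma comp {mY : MeasurableSpace Y} {φ : Y → ℝ} (h : BddMeas mY φ) {T : X → Y}
    (hT : Measurable[m] T) : BddMeas m (fun x => φ (T x)) :=
  ⟨h.1.comp hT, h.2.imp fun _ hC x => hC (T x)⟩

lemma integrable (h : BddMeas m φ) (μ : Measure X) [IsFiniteMeasure μ] : Integrable φ μ := by
  obtain ⟨hm, C, hC⟩ := h
  exact Integrable.of_bound hm.aestronglyMeasurable C (Filter.Eventually.of_forall hC)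

end BddMeas

variable {Z : Type*} [mZ : MeasurableSpace Z]

/-- The action of a kernel on functions. -/
noncomputable def avg (κ : Kernel Z Z) (φ : Z → ℝ) (z : Z) : ℝ := ∫ x, φ x ∂(κ z)

lemma abs_avg_le (κ : Kernel Z Z) [IsMarkovKernel κ] {φ : Z → ℝ} {B : ℝ}
    (h : ∀ z, |φ z| ≤ B) (z : Z) : |avg κ φ z| ≤ B := by
  have := norm_integral_le_of_norm_le_const (μ := κ z) (f := φ) (C := B)
    (Filter.Eventually.of_forall h)
  simpa [avg] using this

lemma BddMeas.avg (κ : Kernel Z Z) [IsMarkovKernel κ] {φ : Z → ℝ} (h : BddMeas mZ φ) :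
    BddMeas mZ (avg κ φ) := by
  obtain ⟨hm, C, hC⟩ := h
  exact ⟨(StronglyMeasurable.integral_kernel hm.stronglyMeasurable).measurable, C, abs_avg_le κ hC⟩

lemma avg_pow_zero (κ : Kernel Z Z) [IsMarkovKernel κ] {φ : Z → ℝ} (h : BddMeas mZ φ) (z : Z) :
    MarkovRosenthal.avg (κ ^ 0) φ z = φ z := by
  rw [pow_zero]
  change ∫ x, φ x ∂(Kernel.id z) = φ z
  rw [Kernel.id_apply, integral_dirac' _ _ h.1.stronglyMeasurable]

lemma avg_comp (κ η : Kernel Z Z) [IsMarkovKernel κ] [IsMarkovKernel η] {φ : Z → ℝ}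
    (h : BddMeas mZ φ) (z : Z) :
    MarkovRosenthal.avg (η ∘ₖ κ) φ z = MarkovRosenthal.avg κ (MarkovRosenthal.avg η φ) z :=
  Kernel.integral_comp (h.integrable _)

lemma avg_pow_succ (κ : Kernel Z Z) [IsMarkovKernel κ] {φ : Z → ℝ} (h : BddMeas mZ φ)
    (n : ℕ) (z : Z) :
    MarkovRosenthal.avg (κ ^ (n + 1)) φ z
      = MarkovRosenthal.avg (κ ^ n) (MarkovRosenthal.avg κ φ) z := by
  rw [pow_succ']
  exact avg_comp (κ ^ n) κ h z

lemma avg_pow_succ' (κ : Kernel Z Z) [IsMarkovKernel κ] {φ : Z → ℝ} (h : BddMeas mZ φ)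
    (n : ℕ) (z : Z) :
    MarkovRosenthal.avg (κ ^ (n + 1)) φ z
      = MarkovRosenthal.avg κ (MarkovRosenthal.avg (κ ^ n) φ) z := by
  rw [pow_succ]
  exact avg_comp κ (κ ^ n) h z

lemma integral_avg {κ : Kernel Z Z} [IsMarkovKernel κ] {π : Measure Z} [IsProbabilityMeasure π]
    (hπ : Kernel.Invariant κ π) {φ : Z → ℝ} (h : BddMeas mZ φ) :
    ∫ z, MarkovRosenthal.avg κ φ z ∂π = ∫ z, φ z ∂π := by
  conv_rhs => rw [← hπ.def]
  rw [Measure.comp_eq_comp_const_apply, Kernel.integral_comp (h.integrable _)]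
  simp [MarkovRosenthal.avg]

lemma invariant_pow {κ : Kernel Z Z} [IsMarkovKernel κ] {π : Measure Z}
    (hπ : Kernel.Invariant κ π) (n : ℕ) : Kernel.Invariant (κ ^ n) π := by
  induction n with
  | zero => rw [pow_zero]; exact Measure.bind_dirac
  | succ n ih => rw [pow_succ]; exact ih.comp hπ

section Chain

variable (Q : Kernel Z Z) [IsMarkovKernel Q] (ξ : Measure Z) [IsProbabilityMeasure ξ]

instance : IsProbabilityMeasure (chainLaw Q ξ) := by
  unfold chainLaw; infer_instance

/-- The `σ`-algebra of the trajectory up to time `k`. -/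
abbrev hist (Z : Type*) [MeasurableSpace Z] (k : ℕ) : MeasurableSpace (ℕ → Z) :=
  MeasurableSpace.comap (Preorder.frestrictLe (π := fun _ : ℕ => Z) k) inferInstance

lemma hist_le (k : ℕ) : hist Z k ≤ (inferInstance : MeasurableSpace (ℕ → Z)) :=
  (Preorder.measurable_frestrictLe (X := fun _ : ℕ => Z) k).comap_le

lemma measurable_hist {i k : ℕ} (h : i ≤ k) : Measurable[hist Z k] (fun ω : ℕ → Z => ω i) := by
  have : (fun ω : ℕ → Z => ω i) = (fun x : (i : Finset.Iic k) → Z => x ⟨i, Finset.mem_Iic.2 h⟩) ∘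
      Preorder.frestrictLe (π := fun _ : ℕ => Z) k := rfl
  rw [this]
  exact (measurable_pi_apply _).comp (comap_measurable _)

lemma hist_mono {i k : ℕ} (h : i ≤ k) : hist Z i ≤ hist Z k := by
  have : Preorder.frestrictLe (π := fun _ : ℕ => Z) i =
      Preorder.frestrictLe₂ (π := fun _ : ℕ => Z) h ∘ Preorder.frestrictLe (π := fun _ => Z) k := rfl
  rw [hist, this]
  exact ((Preorder.measurable_frestrictLe₂ (X := fun _ : ℕ => Z) h).comp
    (comap_measurable _)).comap_le

lemma map_chainLaw_succ (k : ℕ) :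
    (chainLaw Q ξ).map (fun ω => (Preorder.frestrictLe (π := fun _ : ℕ => Z) k ω, ω (k + 1))) =
      (chainLaw Q ξ).map (Preorder.frestrictLe (π := fun _ : ℕ => Z) k) ⊗ₘ
        Q.comap (fun h : (i : Finset.Iic k) → Z => h ⟨k, Finset.mem_Iic.2 le_rfl⟩)
          (measurable_pi_apply _) :=
  (Kernel.map_frestrictLe_trajMeasure_compProd_eq_map_trajMeasure (X := fun _ => Z) (a := k)
    (κ := fun n => Q.comap (fun h : (i : Finset.Iic n) → Z => h ⟨n, Finset.mem_Iic.2 le_rfl⟩)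
      (measurable_pi_apply _))).symm

omit [IsProbabilityMeasure ξ] in
lemma map_chainLaw_zero : (chainLaw Q ξ).map (fun ω => ω 0) = ξ := by
  have h0 : (fun ω : ℕ → Z => ω 0) = (MeasurableEquiv.piUnique (fun _ : Finset.Iic 0 => Z)) ∘
      Preorder.frestrictLe (π := fun _ : ℕ => Z) 0 := rfl
  rw [h0, ← Measure.map_map (MeasurableEquiv.measurable _) (by fun_prop), chainLaw,
    Kernel.trajMeasure, Measure.map_comp _ _ (by fun_prop), Kernel.traj_map_frestrictLe,
    Kernel.partialTraj_self, Measure.id_comp]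
  exact MeasurableEquiv.map_map_symm _

/-- The Markov property in tested form: conditioning on the past is expressed by integrating against
bounded weights `W` that depend on the history only. -/
lemma integral_chainLaw_succ {k : ℕ} {W : (ℕ → Z) → ℝ} (hW : BddMeas (hist Z k) W)
    {φ : Z → ℝ} (hφ : BddMeas mZ φ) :
    ∫ ω, W ω * φ (ω (k + 1)) ∂(chainLaw Q ξ) = ∫ ω, W ω * avg Q φ (ω k) ∂(chainLaw Q ξ) := by
  obtain ⟨W', hW', hWW⟩ := hW.1.exists_eq_measurable_comp
  have hm : Measurable fun ω : ℕ → Z =>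
      (Preorder.frestrictLe (π := fun _ : ℕ => Z) k ω, ω (k + 1)) := by fun_prop
  have hG : Measurable fun x : ((i : Finset.Iic k) → Z) × Z => W' x.1 * φ x.2 :=
    (hW'.comp measurable_fst).mul (hφ.1.comp measurable_snd)
  have hint : Integrable (fun x : ((i : Finset.Iic k) → Z) × Z => W' x.1 * φ x.2)
      ((chainLaw Q ξ).map
        (fun ω => (Preorder.frestrictLe (π := fun _ : ℕ => Z) k ω, ω (k + 1)))) := by
    rw [integrable_map_measure hG.aestronglyMeasurable hm.aemeasurable]
    have := ((hW.mono (hist_le k)).mul (hφ.comp (measurable_pi_apply (k + 1)))).integrable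
      (chainLaw Q ξ)
    rw [hWW] at this
    exact this
  have h1 := integral_map (μ := chainLaw Q ξ) hm.aemeasurable hG.aestronglyMeasurable
  rw [map_chainLaw_succ] at h1 hint
  rw [Measure.integral_compProd hint] at h1
  rw [integral_map (by fun_prop)] at h1
  · rw [hWW]
    simp only [Kernel.comap_apply, integral_const_mul] at h1
    exact h1.symm
  · have : StronglyMeasurable (fun x : ((i : Finset.Iic k) → Z) × Z => W' x.1 * φ x.2) :=
      hG.stronglyMeasurable
    exact (StronglyMeasurable.integral_kernel_prod_right' this).aestronglyMeasurable

/-- The Markov property at time `k`. -/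
lemma lintegral_chainLaw_succ (k : ℕ) {S : (ℕ → Z) → ℝ} (hS : Measurable[hist Z k] S)
    {G : ℝ × Z → ENNReal} (hG : Measurable G) :
    ∫⁻ ω, G (S ω, ω (k + 1)) ∂(chainLaw Q ξ)
      = ∫⁻ ω, ∫⁻ y, G (S ω, y) ∂(Q (ω k)) ∂(chainLaw Q ξ) := by
  obtain ⟨S', hS', rfl⟩ := hS.exists_eq_measurable_comp
  have hm : Measurable fun ω : ℕ → Z =>
      (Preorder.frestrictLe (π := fun _ : ℕ => Z) k ω, ω (k + 1)) := by fun_prop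
  have hG' : Measurable fun x : ((i : Finset.Iic k) → Z) × Z => G (S' x.1, x.2) := by fun_prop
  have h1 := lintegral_map (μ := chainLaw Q ξ) hG' hm
  rw [map_chainLaw_succ, Measure.lintegral_compProd hG', lintegral_map _ (by fun_prop)] at h1
  · exact h1.symm
  · exact hG'.lintegral_kernel_prod_right'

/-- The Markov property at time `k`, over several steps. -/
lemma integral_chainLaw_add {k : ℕ} {W : (ℕ → Z) → ℝ} (hW : BddMeas (hist Z k) W) (i : ℕ)
    {φ : Z → ℝ} (hφ : BddMeas mZ φ) :
    ∫ ω, W ω * φ (ω (k + i)) ∂(chainLaw Q ξ)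
      = ∫ ω, W ω * avg (Q ^ i) φ (ω k) ∂(chainLaw Q ξ) := by
  induction i generalizing φ with
  | zero => simp only [avg_pow_zero Q hφ, add_zero]
  | succ i ih =>
    have := integral_chainLaw_succ Q ξ (hW.mono (hist_mono (Nat.le_add_right k i))) hφ
    simp only [avg_pow_succ Q hφ]
    rw [← ih (hφ.avg Q), ← this]
    rfl

end Chain

/-- Integrals of a bounded function differ by at most the total variation norm times the bound. -/
lemma abs_integral_sub_le_tvNorm (μ ν : Measure Z) [IsProbabilityMeasure μ]
    [IsProbabilityMeasure ν] {φ : Z → ℝ} {B : ℝ} (hm : Measurable φ) (hB : ∀ z, |φ z| ≤ B) :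
    |∫ z, φ z ∂μ - ∫ z, φ z ∂ν| ≤ tvNorm μ ν * B := by
  set s := μ.toSignedMeasure - ν.toSignedMeasure with hs
  set j := s.toJordanDecomposition with hj
  have hφ : BddMeas mZ φ := .of_le hm hB
  -- The Jordan decomposition of μ − ν, rearranged into an identity between positive measures that
  -- can be integrated.
  have hadd : μ + j.negPart = ν + j.posPart := by
    have h := SignedMeasure.toSignedMeasure_toJordanDecomposition s
    rw [JordanDecomposition.toSignedMeasure, hs, sub_eq_sub_iff_add_eq_add] at h
    rw [← Measure.toSignedMeasure_eq_toSignedMeasure_iff, Measure.toSignedMeasure_add,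
      Measure.toSignedMeasure_add, add_comm ν.toSignedMeasure]
    exact h.symm
  have h2 := congrArg (fun m => ∫ z, φ z ∂m) hadd
  simp only [integral_add_measure (hφ.integrable _) (hφ.integrable _)] at h2
  have hp := norm_integral_le_of_norm_le_const (μ := j.posPart) (f := φ) (C := B)
    (Filter.Eventually.of_forall hB)
  have hn := norm_integral_le_of_norm_le_const (μ := j.negPart) (f := φ) (C := B)
    (Filter.Eventually.of_forall hB)
  have htv : tvNorm μ ν = j.posPart.real Set.univ + j.negPart.real Set.univ := by
    rw [tvNorm, SignedMeasure.totalVariation, Measure.add_apply,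
      ENNReal.toReal_add (measure_ne_top _ _) (measure_ne_top _ _)]
    rfl
  have h3 : ∫ z, φ z ∂μ - ∫ z, φ z ∂ν = ∫ z, φ z ∂j.posPart - ∫ z, φ z ∂j.negPart := by linarith
  rw [h3, htv]
  calc _ ≤ |∫ z, φ z ∂j.posPart| + |∫ z, φ z ∂j.negPart| := abs_sub _ _
    _ ≤ _ := by
      rw [Real.norm_eq_abs] at hp hn
      nlinarith

lemma IsUniformlyGeometricallyErgodic.abs_avg_sub_le {Q : Kernel Z Z} [IsMarkovKernel Q]
    {π : Measure Z} [IsProbabilityMeasure π] {τ : ℕ} (hQ : IsUniformlyGeometricallyErgodic Q π τ)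
    {φ : Z → ℝ} {B : ℝ} (hm : Measurable φ) (hB : ∀ z, |φ z| ≤ B) (n : ℕ) (z : Z) :
    |avg (Q ^ n) φ z - ∫ x, φ x ∂π| ≤ 2 * B * (1 / 4) ^ (n / τ) := by
  have h1 := abs_integral_sub_le_tvNorm ((Q ^ n) z) π hm hB
  have h2 := hQ.tv_le n z
  have hB0 : 0 ≤ B := (abs_nonneg _).trans (hB z)
  refine h1.trans ?_
  nlinarith

end

/-! ### Poisson equations and the block martingale -/

section

/-- Writing k = τq + r with r < τ, each power (1/4)^q occurs τ times. -/
lemma hasSum_pow_div {τ : ℕ} (hτ : 0 < τ) :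
    HasSum (fun k : ℕ => (1 / 4 : ℝ) ^ (k / τ)) (4 / 3 * τ) := by
  have : NeZero τ := ⟨hτ.ne'⟩
  rw [← (Nat.divModEquiv τ).symm.hasSum_iff]
  have h1 : HasSum (fun k : ℕ => (1 / 4 : ℝ) ^ k) (4 / 3) := by
    have := hasSum_geometric_of_lt_one (r := (1 / 4 : ℝ)) (by norm_num) (by norm_num)
    convert this using 1
    norm_num
  have h2 : HasSum (fun _ : Fin τ => (1 : ℝ)) τ := by
    have := hasSum_fintype (fun _ : Fin τ => (1 : ℝ))
    simpa using this
  have h3 := h1.mul h2 (h1.summable.mul_of_nonneg h2.summable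
    (fun k => by positivity) (fun _ => zero_le_one))
  have e : (fun k : ℕ => (1 / 4 : ℝ) ^ (k / τ)) ∘ (Nat.divModEquiv τ).symm
      = fun x : ℕ × Fin τ => (1 / 4 : ℝ) ^ x.1 * 1 := by
    funext x
    have : (τ * x.1 + x.2 : ℕ) / τ = x.1 := by
      rw [Nat.mul_add_div hτ, Nat.div_eq_of_lt x.2.2, add_zero]
    simp [Nat.divModEquiv, mul_comm x.1 τ, this]
  rw [e]
  exact h3

variable {Z : Type*} [mZ : MeasurableSpace Z]

lemma hasSum_integral_of_abs_le {X : Type*} [MeasurableSpace X] (μ : Measure X)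
    [IsProbabilityMeasure μ] {F : ℕ → X → ℝ} {a : ℕ → ℝ} (ha : Summable a)
    (hF : ∀ k, Measurable (F k)) (hb : ∀ k z, |F k z| ≤ a k) :
    HasSum (fun k => ∫ z, F k z ∂μ) (∫ z, ∑' k, F k z ∂μ) := by
  have hi : ∀ k, BddMeas _ (F k) := fun k => .of_le (hF k) (hb k)
  refine hasSum_integral_of_summable_integral_norm (fun k => (hi k).integrable μ) ?_
  refine Summable.of_nonneg_of_le (fun k => integral_nonneg fun _ => norm_nonneg _)
    (fun k => ?_) ha
  have := integral_mono (μ := μ) ((hi k).integrable μ).norm (integrable_const (a k)) (hb k)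
  simpa using this

/-- The potential `∑ κ ^ k φ` of a function. -/
noncomputable def potential (κ : Kernel Z Z) (φ : Z → ℝ) (z : Z) : ℝ :=
  ∑' k : ℕ, avg (κ ^ k) φ z

section Potential

variable {κ : Kernel Z Z} [IsMarkovKernel κ] {φ : Z → ℝ} {a : ℕ → ℝ} {A : ℝ}

omit [IsMarkovKernel κ] in
lemma abs_potential_le (ha : HasSum a A) (hb : ∀ k z, |avg (κ ^ k) φ z| ≤ a k) (z : Z) :
    |potential κ φ z| ≤ A :=
  tsum_of_norm_bounded (f := fun k => avg (κ ^ k) φ z) ha (fun k => hb k z)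

lemma bddMeas_potential (hφ : BddMeas mZ φ) (ha : HasSum a A)
    (hb : ∀ k z, |avg (κ ^ k) φ z| ≤ a k) : BddMeas mZ (potential κ φ) := by
  refine .of_le ?_ (abs_potential_le ha hb)
  have hs : ∀ z, Summable fun k => avg (κ ^ k) φ z := fun z =>
    Summable.of_norm_bounded ha.summable (fun k => hb k z)
  refine measurable_of_tendsto_metrizable (f := fun n z => ∑ k ∈ Finset.range n, avg (κ ^ k) φ z)
    (fun n => ?_) (tendsto_pi_nhds.2 fun z => (hs z).hasSum.tendsto_sum_nat)
  exact Finset.measurable_sum _ fun k _ => (hφ.avg (κ ^ k)).1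

/-- The Poisson equation. -/
lemma potential_sub_avg (hφ : BddMeas mZ φ) (ha : HasSum a A)
    (hb : ∀ k z, |avg (κ ^ k) φ z| ≤ a k) (z : Z) :
    potential κ φ z - avg κ (potential κ φ) z = φ z := by
  have hs : Summable fun k => avg (κ ^ k) φ z :=
    Summable.of_norm_bounded ha.summable (fun k => hb k z)
  have h1 := (hasSum_integral_of_abs_le (κ z) ha.summable (fun k => (hφ.avg (κ ^ k)).1) hb).tsum_eq
  have h2 : avg κ (potential κ φ) z = ∑' k, avg (κ ^ (k + 1)) φ z := by
    simp only [avg_pow_succ' κ hφ]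
    exact h1.symm
  rw [h2, potential, hs.tsum_eq_zero_add, avg_pow_zero κ hφ]
  ring

lemma hasSum_integral_mul_potential (μ : Measure Z) [IsProbabilityMeasure μ] {ψ : Z → ℝ}
    (hψ : BddMeas mZ ψ) (hφ : BddMeas mZ φ) (ha : HasSum a A)
    (hb : ∀ k z, |avg (κ ^ k) φ z| ≤ a k) :
    HasSum (fun k => ∫ z, ψ z * avg (κ ^ k) φ z ∂μ) (∫ z, ψ z * potential κ φ z ∂μ) := by
  obtain ⟨C, hC⟩ := hψ.2
  have := hasSum_integral_of_abs_le μ (F := fun k z => ψ z * avg (κ ^ k) φ z)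
    (ha.summable.mul_left C) (fun k => hψ.1.mul (hφ.avg (κ ^ k)).1) (fun k z => by
      rw [abs_mul]
      exact mul_le_mul (hC z) (hb k z) (abs_nonneg _) ((abs_nonneg _).trans (hC z)))
  simpa only [tsum_mul_left, potential] using this

end Potential

section Block

variable (Q : Kernel Z Z) [IsMarkovKernel Q] (ξ : Measure Z) [IsProbabilityMeasure ξ]

/-- The conditional variance of `g (Z_1)` given `Z_0`. -/
noncomputable def condVar (g : Z → ℝ) (z : Z) : ℝ := avg Q (fun x => g x ^ 2) z - avg Q g z ^ 2

/-- The expectation of the quadratic variation over `n` steps. -/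
noncomputable def blockVar (g : Z → ℝ) (n : ℕ) (z : Z) : ℝ :=
  ∑ j ∈ Finset.range n, avg (Q ^ j) (condVar Q g) z

/-- The martingale associated with `g` between times `k` and `k + n`. -/
noncomputable def blockIncr (g : Z → ℝ) (k n : ℕ) (ω : ℕ → Z) : ℝ :=
  ∑ j ∈ Finset.range n, (g (ω (k + j)) - avg Q g (ω (k + j))) + g (ω (k + n)) - g (ω k)

variable {Q} {g : Z → ℝ}

lemma bddMeas_condVar (hg : BddMeas mZ g) : BddMeas mZ (condVar Q g) :=
  (hg.sq.avg Q).sub (hg.avg Q).sq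

lemma bddMeas_blockVar (hg : BddMeas mZ g) (n : ℕ) : BddMeas mZ (blockVar Q g n) :=
  BddMeas.sum _ fun j _ => (bddMeas_condVar hg).avg (Q ^ j)

lemma BddMeas.eval {φ : Z → ℝ} (h : BddMeas mZ φ) {i k : ℕ} (hik : i ≤ k) :
    BddMeas (hist Z k) (fun ω => φ (ω i)) := h.comp (measurable_hist hik)

lemma bddMeas_blockIncr (hg : BddMeas mZ g) (k n : ℕ) :
    BddMeas (hist Z (k + n)) (blockIncr Q g k n) := by
  have h1 : ∀ j ∈ Finset.range n, BddMeas (hist Z (k + n))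
      (fun ω => g (ω (k + j)) - avg Q g (ω (k + j))) := fun j hj =>
    have hj' : k + j ≤ k + n := by have := Finset.mem_range.1 hj; omega
    (hg.eval hj').sub ((hg.avg Q).eval hj')
  exact ((BddMeas.sum _ h1).add (hg.eval le_rfl)).sub (hg.eval (Nat.le_add_right k n))

-- `blockIncr` is a telescoped form; this recursion recovers the martingale differences g(Z_{i+1}) −
-- Qg(Z_i).
omit [IsMarkovKernel Q] in
lemma blockIncr_succ (k n : ℕ) (ω : ℕ → Z) : blockIncr Q g k (n + 1) ω =
    blockIncr Q g k n ω + (g (ω (k + n + 1)) - avg Q g (ω (k + n))) := by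
  simp only [blockIncr, Finset.sum_range_succ, ← add_assoc]
  ring

lemma integral_mul_blockIncr (hg : BddMeas mZ g) {k : ℕ} {W : (ℕ → Z) → ℝ}
    (hW : BddMeas (hist Z k) W) (n : ℕ) :
    ∫ ω, W ω * blockIncr Q g k n ω ∂(chainLaw Q ξ) = 0 := by
  induction n with
  | zero => simp [blockIncr]
  | succ n ih =>
    have hW' := hW.mono (hist_mono (Nat.le_add_right k n))
    have hk := hist_le (Z := Z) (k + n)
    simp only [blockIncr_succ, mul_add, mul_sub]
    have i1 := (hW'.mul (bddMeas_blockIncr (Q := Q) hg k n)).mono hk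
    have i2 := (hW'.mono hk).mul (hg.comp (measurable_pi_apply (k + n + 1)))
    have i3 := (hW'.mul ((hg.avg Q).eval le_rfl)).mono hk
    rw [integral_add (i1.integrable _) ((i2.sub i3).integrable _),
      integral_sub (i2.integrable _) (i3.integrable _), ih, integral_chainLaw_succ Q ξ hW' hg]
    ring

/-- Martingale differences are orthogonal, so each step adds exactly its conditional variance. -/
lemma integral_mul_blockIncr_sq (hg : BddMeas mZ g) {k : ℕ} {W : (ℕ → Z) → ℝ}
    (hW : BddMeas (hist Z k) W) (n : ℕ) :
    ∫ ω, W ω * blockIncr Q g k n ω ^ 2 ∂(chainLaw Q ξ)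
      = ∫ ω, W ω * blockVar Q g n (ω k) ∂(chainLaw Q ξ) := by
  induction n with
  | zero => simp [blockIncr, blockVar]
  | succ n ih =>
    have hW' := hW.mono (hist_mono (Nat.le_add_right k n))
    have hk := hist_le (Z := Z) (k + n)
    have hD := bddMeas_blockIncr (Q := Q) hg k n
    have ha : BddMeas (hist Z (k + n)) (fun ω => avg Q g (ω (k + n))) := (hg.avg Q).eval le_rfl
    have hV1 : BddMeas (hist Z (k + n))
      (fun ω => W ω * (2 * blockIncr Q g k n ω - 2 * avg Q g (ω (k + n)))) :=
      hW'.mul ((hD.const_mul 2).sub (ha.const_mul 2))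
    have hV2 : BddMeas (hist Z (k + n)) (fun ω => W ω * (avg Q g (ω (k + n)) ^ 2
        - 2 * blockIncr Q g k n ω * avg Q g (ω (k + n)))) :=
      hW'.mul (ha.sq.sub ((hD.const_mul 2).mul ha))
    -- The square is sorted by powers of g(Z_{k+n+1}). The coefficients depend on the history up to
    -- k + n, so the Markov property applies term by term, and what is added collapses to `condVar`.
    have e : ∀ ω, W ω * blockIncr Q g k (n + 1) ω ^ 2 = W ω * blockIncr Q g k n ω ^ 2
        + (W ω * g (ω (k + n + 1)) ^ 2
        + (W ω * (2 * blockIncr Q g k n ω - 2 * avg Q g (ω (k + n))) * g (ω (k + n + 1))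
        + W ω * (avg Q g (ω (k + n)) ^ 2
          - 2 * blockIncr Q g k n ω * avg Q g (ω (k + n))))) := fun ω => by
      rw [blockIncr_succ]; ring
    have e' : ∀ ω, W ω * blockVar Q g (n + 1) (ω k) = W ω * blockVar Q g n (ω k)
        + W ω * avg (Q ^ n) (condVar Q g) (ω k) := fun ω => by
      rw [blockVar, Finset.sum_range_succ, mul_add]; rfl
    have hev := measurable_pi_apply (X := fun _ : ℕ => Z) (k + n + 1)
    have i1 := (hW'.mul hD.sq).mono hk
    have i2 := (hW'.mono hk).mul (hg.sq.comp hev)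
    have i3 := (hV1.mono hk).mul (hg.comp hev)
    have i4 := hV2.mono hk
    have j1 := (hW.mul ((bddMeas_blockVar (Q := Q) hg n).eval le_rfl)).mono (hist_le k)
    have j2 := (hW.mul (((bddMeas_condVar (Q := Q) hg).avg (Q ^ n)).eval le_rfl)).mono (hist_le k)
    have k2 := (hW'.mul ((hg.sq.avg Q).eval le_rfl)).mono hk
    have k3 := (hV1.mul ha).mono hk
    simp only [e, e']
    rw [integral_add (i1.integrable _) ((i2.add (i3.add i4)).integrable _),
      integral_add (i2.integrable _) ((i3.add i4).integrable _),
      integral_add (i3.integrable _) (i4.integrable _),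
      integral_add (j1.integrable _) (j2.integrable _), ih, integral_chainLaw_succ Q ξ hW' hg.sq,
      integral_chainLaw_succ Q ξ hV1 hg, ← integral_chainLaw_add Q ξ hW n (bddMeas_condVar hg),
      ← integral_add (k3.integrable _) (i4.integrable _),
      ← integral_add (k2.integrable _) ((k3.add i4).integrable _)]
    congr 1
    refine integral_congr_ae (Filter.Eventually.of_forall fun ω => ?_)
    simp only [condVar]
    ring

end Block

end

/-! ### Exponential moments and the asymptotic variance -/

section

variable {Z : Type*} [mZ : MeasurableSpace Z]
variable {Q : Kernel Z Z} [IsMarkovKernel Q]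

lemma condVar_nonneg {g : Z → ℝ} (hg : BddMeas mZ g) (z : Z) : 0 ≤ condVar Q g z := by
  have h : 0 ≤ ∫ x, (g x - avg Q g z) ^ 2 ∂(Q z) := integral_nonneg fun _ => sq_nonneg _
  have e : ∀ x, (g x - avg Q g z) ^ 2 = g x ^ 2 - (2 * avg Q g z * g x - avg Q g z ^ 2) :=
    fun x => by ring
  have b1 : BddMeas mZ (fun x => 2 * avg Q g z * g x) := hg.const_mul _
  simp only [e] at h
  rw [integral_sub (hg.sq.integrable _) ((b1.sub (.const _)).integrable _),
    integral_sub (b1.integrable _) (integrable_const _), integral_const_mul] at h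
  simp only [integral_const, probReal_univ, smul_eq_mul, one_mul] at h
  change 0 ≤ avg Q (fun x => g x ^ 2) z - (2 * avg Q g z * avg Q g z - avg Q g z ^ 2) at h
  rw [condVar]
  linarith

lemma integral_blockVar {π : Measure Z} [IsProbabilityMeasure π] (hπ : Kernel.Invariant Q π)
    {g : Z → ℝ} (hg : BddMeas mZ g) (n : ℕ) :
    ∫ z, blockVar Q g n z ∂π = n * ∫ z, condVar Q g z ∂π := by
  unfold blockVar
  rw [integral_finsetSum _ fun j _ => ((bddMeas_condVar hg).avg (Q ^ j)).integrable π]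
  simp [integral_avg (invariant_pow hπ _) (bddMeas_condVar (Q := Q) hg)]

/-- For the chain started at z, `blockVar Q g n z` is the second moment of `blockIncr`. -/
lemma abs_blockVar_le {g : Z → ℝ} (hg : BddMeas mZ g) {n : ℕ} {L : ℝ}
    (hL : ∀ ω, |blockIncr Q g 0 n ω| ≤ L) (z : Z) : |blockVar Q g n z| ≤ L ^ 2 := by
  have h := integral_mul_blockIncr_sq (Q := Q) (Measure.dirac z) hg
    (BddMeas.const (m := hist Z 0) 1) n
  simp only [one_mul] at h
  have h2 : ∫ ω, blockVar Q g n (ω 0) ∂(chainLaw Q (Measure.dirac z)) = blockVar Q g n z := by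
    have hb := bddMeas_blockVar (Q := Q) hg n
    have := integral_map (μ := chainLaw Q (Measure.dirac z)) (φ := fun ω => ω 0)
      (measurable_pi_apply 0).aemeasurable (f := blockVar Q g n) hb.1.aestronglyMeasurable
    rw [← this, map_chainLaw_zero, integral_dirac' _ _ hb.1.stronglyMeasurable]
  have h3 : 0 ≤ blockVar Q g n z := by
    rw [← h2, ← h]; exact integral_nonneg fun _ => sq_nonneg _
  rw [abs_of_nonneg h3, ← h2, ← h]
  have hi : BddMeas _ (fun ω : ℕ → Z => blockIncr Q g 0 n ω ^ 2) :=
    ((bddMeas_blockIncr (Q := Q) hg 0 n).mono (hist_le _)).sq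
  have := integral_mono (μ := chainLaw Q (Measure.dirac z)) (hi.integrable _)
    (integrable_const (L ^ 2)) (fun ω => sq_le_sq' (abs_le.1 (hL ω)).1 (abs_le.1 (hL ω)).2)
  simpa using this

/-- Exponential moments of additive functionals, by means of a supermartingale built from the
solutions of two Poisson equations. -/
lemma integral_exp_le (ξ : Measure Z) [IsProbabilityMeasure ξ] {g u : Z → ℝ} {G U V L : ℝ} {τ : ℕ}
    (hg : Measurable g) (hG : ∀ z, |g z| ≤ G) (hu : Measurable u) (hU : ∀ z, |u z| ≤ U)
    (hL : ∀ k ω, |blockIncr Q g k τ ω| ≤ L)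
    (hpoisson : ∀ z, u z - avg (Q ^ τ) u z = 2 * (blockVar Q g τ z - V))
    {θ : ℝ} (hθ : |θ| * L + θ ^ 2 * (2 * U) ≤ 1) (m : ℕ) :
    ∫ ω, Real.exp (θ * ∑ i ∈ Finset.range (m * τ), (g (ω i) - avg Q g (ω i))) ∂(chainLaw Q ξ)
      ≤ Real.exp (m * (2 * θ ^ 2 * V + 8 * θ ^ 4 * U ^ 2) + 2 * (|θ| * G + θ ^ 2 * U)) := by
  have bg : BddMeas mZ g := .of_le hg hG
  have bu : BddMeas mZ u := .of_le hu hU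
  set P := chainLaw Q ξ
  set S : ℕ → (ℕ → Z) → ℝ := fun k ω => ∑ i ∈ Finset.range k, (g (ω i) - avg Q g (ω i)) with hS
  have bS : ∀ k, BddMeas (hist Z k) (S k) := fun k => BddMeas.sum _ fun i hi =>
    (bg.eval (Finset.mem_range.1 hi).le).sub ((bg.avg Q).eval (Finset.mem_range.1 hi).le)
  set W : ℕ → (ℕ → Z) → ℝ := fun k ω => Real.exp (θ * (S k ω + g (ω k)) + θ ^ 2 * u (ω k)) with hW
  have bW : ∀ k, BddMeas (hist Z k) (W k) := fun k =>
    ((((bS k).add (bg.eval le_rfl)).const_mul θ).add ((bu.eval le_rfl).const_mul (θ ^ 2))).exp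
  have hedge : ∀ z, |θ * g z + θ ^ 2 * u z| ≤ |θ| * G + θ ^ 2 * U := fun z => by
    refine (abs_add_le _ _).trans (add_le_add ?_ ?_)
    · rw [abs_mul]; exact mul_le_mul_of_nonneg_left (hG z) (abs_nonneg _)
    · rw [abs_mul, abs_of_nonneg (sq_nonneg θ)]
      exact mul_le_mul_of_nonneg_left (hU z) (sq_nonneg _)
  set K := 2 * θ ^ 2 * V + 8 * θ ^ 4 * U ^ 2
  -- Given the past, the block increment D has mean 0 and second moment H, and the increment Δ of u
  -- has mean Q^τ u − u = −2(H − V). In 2θ²D² + θ²Δ the random H therefore cancels and 2θ²V remains.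
  have hstep : ∀ k, ∫ ω, W (k + τ) ω ∂P ≤ Real.exp K * ∫ ω, W k ω ∂P := by
    intro k
    have bD := bddMeas_blockIncr (Q := Q) bg k τ
    have bW' := (bW k).mono (hist_mono (Nat.le_add_right k τ))
    have hfac : ∀ ω, W (k + τ) ω
        = W k ω * Real.exp (θ * blockIncr Q g k τ ω + θ ^ 2 * (u (ω (k + τ)) - u (ω k))) := by
      intro ω
      simp only [hW, ← Real.exp_add, hS, blockIncr, Finset.sum_range_add]
      congr 1
      ring
    have hpt : ∀ ω, W (k + τ) ω ≤ (1 + 8 * θ ^ 4 * U ^ 2) * W k ω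
        + (θ * (W k ω * blockIncr Q g k τ ω) + (θ ^ 2 * (W k ω * u (ω (k + τ)))
        - (θ ^ 2 * (W k ω * u (ω k)) - 2 * θ ^ 2 * (W k ω * blockIncr Q g k τ ω ^ 2)))) := by
      intro ω
      rw [hfac]
      set D := blockIncr Q g k τ ω
      have hΔ : |u (ω (k + τ)) - u (ω k)| ≤ 2 * U := by
        have := abs_le.1 (hU (ω (k + τ)))
        have := abs_le.1 (hU (ω k))
        rw [abs_le]; constructor <;> linarith
      set Δ := u (ω (k + τ)) - u (ω k) with hΔd
      have hx : |θ * D + θ ^ 2 * Δ| ≤ 1 := by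
        refine le_trans ((abs_add_le _ _).trans (add_le_add ?_ ?_)) hθ
        · rw [abs_mul]; exact mul_le_mul_of_nonneg_left (hL k ω) (abs_nonneg _)
        · rw [abs_mul, abs_of_nonneg (sq_nonneg θ)]
          exact mul_le_mul_of_nonneg_left hΔ (sq_nonneg _)
      -- For |x| ≤ 1, e^x ≤ 1 + x + x²; then x² ≤ 2θ²D² + 2θ⁴Δ² and |Δ| ≤ 2U.
      have h1 := (abs_le.1 (Real.abs_exp_sub_one_sub_id_le hx)).2
      have h2 : Real.exp (θ * D + θ ^ 2 * Δ)
          ≤ 1 + θ * D + θ ^ 2 * Δ + 2 * θ ^ 2 * D ^ 2 + 8 * θ ^ 4 * U ^ 2 := by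
        have h3 : Δ ^ 2 ≤ (2 * U) ^ 2 := sq_le_sq' (abs_le.1 hΔ).1 (abs_le.1 hΔ).2
        have h4 : θ ^ 4 * Δ ^ 2 ≤ θ ^ 4 * (2 * U) ^ 2 :=
          mul_le_mul_of_nonneg_left h3 (by positivity)
        nlinarith [sq_nonneg (θ * D - θ ^ 2 * Δ)]
      have h3 := mul_le_mul_of_nonneg_left h2 (Real.exp_pos _ : 0 < W k ω).le
      refine h3.trans_eq ?_
      rw [hΔd]
      ring
    have hm := hist_le (Z := Z) (k + τ)
    have b1 := ((bW k).mono (hist_le k)).const_mul (1 + 8 * θ ^ 4 * U ^ 2)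
    have b2 := ((bW'.mul bD).mono hm).const_mul θ
    have b3 := ((bW'.mul (bu.eval le_rfl)).mono hm).const_mul (θ ^ 2)
    have b4 := (((bW k).mul (bu.eval le_rfl)).mono (hist_le k)).const_mul (θ ^ 2)
    have b5 := ((bW'.mul bD.sq).mono hm).const_mul (2 * θ ^ 2)
    have c1 := (((bW k).mul ((bu.avg (Q ^ τ)).eval le_rfl)).mono (hist_le k)).const_mul (θ ^ 2)
    have c2 := (((bW k).mul ((bddMeas_blockVar (Q := Q) bg τ).eval le_rfl)).mono
      (hist_le k)).const_mul (2 * θ ^ 2)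
    have hmono := integral_mono (μ := P) (((bW (k + τ)).mono hm).integrable P)
      ((b1.add (b2.add (b3.sub (b4.sub b5)))).integrable P) hpt
    refine hmono.trans ?_
    rw [integral_add (b1.integrable P) ((b2.add (b3.sub (b4.sub b5))).integrable P),
      integral_add (b2.integrable P) ((b3.sub (b4.sub b5)).integrable P),
      integral_sub (b3.integrable P) ((b4.sub b5).integrable P),
      integral_sub (b4.integrable P) (b5.integrable P), integral_const_mul θ,
      integral_mul_blockIncr ξ bg (bW k) τ, integral_const_mul (θ ^ 2),
      integral_chainLaw_add Q ξ (bW k) τ bu, integral_const_mul (2 * θ ^ 2),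
      integral_mul_blockIncr_sq ξ bg (bW k) τ, ← integral_const_mul (θ ^ 2),
      ← integral_const_mul (2 * θ ^ 2), ← integral_sub (b4.integrable P) (c2.integrable P),
      ← integral_sub (c1.integrable P) ((b4.sub c2).integrable P), mul_zero, zero_add,
      ← integral_add (b1.integrable P) ((c1.sub (b4.sub c2)).integrable P)]
    have e : ∀ ω, (1 + 8 * θ ^ 4 * U ^ 2) * W k ω + (θ ^ 2 * (W k ω * avg (Q ^ τ) u (ω k))
        - (θ ^ 2 * (W k ω * u (ω k)) - 2 * θ ^ 2 * (W k ω * blockVar Q g τ (ω k))))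
        = (1 + K) * W k ω := by
      intro ω
      linear_combination (-θ ^ 2 * W k ω) * hpoisson (ω k)
    simp only [e]
    rw [integral_const_mul]
    refine mul_le_mul_of_nonneg_right ?_ (integral_nonneg fun _ => (Real.exp_pos _).le)
    linarith [Real.add_one_le_exp K]
  have hW0 : ∫ ω, W 0 ω ∂P ≤ Real.exp (|θ| * G + θ ^ 2 * U) := by
    have := integral_mono (μ := P) (((bW 0).mono (hist_le 0)).integrable P)
      (integrable_const (Real.exp (|θ| * G + θ ^ 2 * U))) (fun ω => by
        simp only [hW, hS, Finset.range_zero, Finset.sum_empty, zero_add]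
        exact Real.exp_le_exp.2 ((le_abs_self _).trans (hedge _)))
    simpa using this
  have hWm : ∫ ω, W (m * τ) ω ∂P ≤ Real.exp (m * K + (|θ| * G + θ ^ 2 * U)) := by
    induction m with
    | zero => simpa using hW0
    | succ m ih =>
      rw [Nat.succ_mul]
      refine (hstep _).trans ((mul_le_mul_of_nonneg_left ih (Real.exp_pos _).le).trans_eq ?_)
      rw [← Real.exp_add]
      congr 1
      push_cast
      ring
  -- Dropping g and u at the final time costs the boundary factor a second time, hence the 2 in the
  -- conclusion.
  have hfin := integral_mono (μ := P)
    ((((bS (m * τ)).const_mul θ).exp.mono (hist_le _)).integrable P)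
    ((((bW (m * τ)).const_mul (Real.exp (|θ| * G + θ ^ 2 * U))).mono (hist_le _)).integrable P)
    (fun ω => by
      simp only [hW, ← Real.exp_add]
      refine Real.exp_le_exp.2 ?_
      have := (abs_le.1 (hedge (ω (m * τ)))).1
      linarith)
  refine hfin.trans ?_
  rw [integral_const_mul]
  refine (mul_le_mul_of_nonneg_left hWm (Real.exp_pos _).le).trans_eq ?_
  rw [← Real.exp_add]
  congr 1
  ring

section Ergodic

variable {π : Measure Z} [IsProbabilityMeasure π] {τ : ℕ} {f : Z → ℝ}

omit [IsProbabilityMeasure π] in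
lemma bddMeas_centered (hf : Measurable f) (hf1 : ∀ z, |f z| ≤ 1) :
    BddMeas mZ (centered π f) :=
  (BddMeas.of_le hf hf1).sub (.const _)

lemma abs_centered_le (hf1 : ∀ z, |f z| ≤ 1) (z : Z) : |centered π f z| ≤ 2 := by
  have h1 := norm_integral_le_of_norm_le_const (μ := π) (f := f) (C := 1)
    (Filter.Eventually.of_forall hf1)
  simp only [probReal_univ, mul_one, Real.norm_eq_abs] at h1
  exact (abs_sub _ _).trans (by linarith [hf1 z])

variable (hQ : IsUniformlyGeometricallyErgodic Q π τ)
include hQ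

lemma abs_avg_pow_centered_le (hf : Measurable f) (hf1 : ∀ z, |f z| ≤ 1) (k : ℕ) (z : Z) :
    |avg (Q ^ k) (centered π f) z| ≤ 2 * (1 / 4) ^ (k / τ) := by
  have h := hQ.abs_avg_sub_le hf hf1 k z
  have e : avg (Q ^ k) (centered π f) z = avg (Q ^ k) f z - ∫ x, f x ∂π := by
    unfold avg centered
    rw [integral_sub ((BddMeas.of_le hf hf1).integrable _) (integrable_const _)]
    simp
  rw [e]
  linarith

lemma hasSum_rate : HasSum (fun k : ℕ => (2 : ℝ) * (1 / 4) ^ (k / τ)) (8 / 3 * τ) := by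
  have h := (hasSum_pow_div hQ.mixingTime_pos).mul_left 2
  rwa [show (2 : ℝ) * (4 / 3 * τ) = 8 / 3 * τ by ring] at h

lemma summable_autocov (hf : Measurable f) (hf1 : ∀ z, |f z| ≤ 1) :
    Summable (autocov Q π f) :=
  (hasSum_integral_mul_potential π (bddMeas_centered hf hf1) (bddMeas_centered hf hf1)
    (hasSum_rate hQ) (abs_avg_pow_centered_le hQ hf hf1)).summable

/-- By invariance the right side is π(g² − (Qg)²). Since Qg = g − f̄, the integrand is 2f̄g − f̄²,
and π(f̄g) is the sum of all autocovariances from ℓ = 0 on. -/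
lemma asymptoticVariance_eq (hf : Measurable f) (hf1 : ∀ z, |f z| ≤ 1) :
    asymptoticVariance Q π f = ∫ z, condVar Q (potential Q (centered π f)) z ∂π := by
  have bf := bddMeas_centered (π := π) hf hf1
  have hs := hasSum_integral_mul_potential π bf bf (hasSum_rate hQ)
    (abs_avg_pow_centered_le hQ hf hf1)
  have bg := bddMeas_potential bf (hasSum_rate hQ) (abs_avg_pow_centered_le hQ hf hf1)
  have hP := potential_sub_avg bf (hasSum_rate hQ) (abs_avg_pow_centered_le hQ hf hf1)
  set g := potential Q (centered π f)
  have h1 := hs.summable.tsum_eq_zero_add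
  rw [hs.tsum_eq] at h1
  simp only [avg_pow_zero Q bf] at h1
  unfold asymptoticVariance condVar
  rw [integral_sub ((bg.sq.avg Q).integrable _) ((bg.avg Q).sq.integrable _),
    integral_avg hQ.invariant bg.sq, ← integral_sub (bg.sq.integrable _)
      ((bg.avg Q).sq.integrable _)]
  have e : ∀ z, g z ^ 2 - avg Q g z ^ 2
      = 2 * (centered π f z * g z) - centered π f z * centered π f z := fun z => by
    rw [← hP z]; ring
  simp only [e]
  rw [integral_sub (((bf.mul bg).const_mul 2).integrable _) ((bf.mul bf).integrable _),
    integral_const_mul, h1]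
  simp only [pow_two]
  change _ = 2 * (_ + ∑' l, autocov Q π f (l + 1)) - _
  ring

lemma asymptoticVariance_nonneg (hf : Measurable f) (hf1 : ∀ z, |f z| ≤ 1) :
    0 ≤ asymptoticVariance Q π f := by
  rw [asymptoticVariance_eq hQ hf hf1]
  exact integral_nonneg (condVar_nonneg (bddMeas_potential (bddMeas_centered hf hf1)
    (hasSum_rate hQ) (abs_avg_pow_centered_le hQ hf hf1)))

lemma integral_exp_block_le (ξ : Measure Z) [IsProbabilityMeasure ξ]
    (hf : Measurable f) (hf1 : ∀ z, |f z| ≤ 1) {θ : ℝ} (hθ : |θ| * (40 * τ) ≤ 1) (m : ℕ) :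
    ∫ ω, Real.exp (θ * centeredSum π f (m * τ) ω) ∂(chainLaw Q ξ)
      ≤ Real.exp (2 * (m * τ) * θ ^ 2 * asymptoticVariance Q π f
        + 1000000 * (m * τ) * τ ^ 3 * θ ^ 4 + 1) := by
  have bf := bddMeas_centered (π := π) hf hf1
  have hτ : (1 : ℝ) ≤ τ := by exact_mod_cast hQ.mixingTime_pos
  have hb := abs_avg_pow_centered_le hQ hf hf1
  have bg := bddMeas_potential bf (hasSum_rate hQ) hb
  have hG := abs_potential_le (hasSum_rate hQ) hb
  have hP := potential_sub_avg bf (hasSum_rate hQ) hb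
  have hvar := asymptoticVariance_eq hQ hf hf1
  set g := potential Q (centered π f)
  -- There are τ terms of size at most 2 and two values of g of size at most (8/3)τ: 22τ/3 in all.
  have hL : ∀ k ω, |blockIncr Q g k τ ω| ≤ 8 * τ := by
    intro k ω
    have h1 : |∑ j ∈ Finset.range τ, (g (ω (k + j)) - avg Q g (ω (k + j)))| ≤ τ * 2 := by
      refine (Finset.abs_sum_le_sum_abs _ _).trans ?_
      have := Finset.sum_le_card_nsmul (Finset.range τ)
        (fun j => |g (ω (k + j)) - avg Q g (ω (k + j))|) 2
        (fun j _ => by rw [hP]; exact abs_centered_le hf1 _)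
      simpa using this
    have h2 := abs_le.1 (hG (ω (k + τ)))
    have h3 := abs_le.1 (hG (ω k))
    have h4 := abs_le.1 h1
    unfold blockIncr
    rw [abs_le]
    constructor <;> linarith
  have hH := abs_blockVar_le bg (hL 0)
  have bH := bddMeas_blockVar (Q := Q) bg τ
  have hV := integral_blockVar hQ.invariant bg τ
  rw [← hvar] at hV
  set V := (τ : ℝ) * asymptoticVariance Q π f
  have bψ : BddMeas mZ (fun z => 2 * (blockVar Q g τ z - V)) := (bH.sub (.const V)).const_mul 2
  -- 256 = 2 · 2 · 64: the prefactor, the 2 in `abs_avg_sub_le`, and the bound (8τ)² for the block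
  -- variance.
  have hψ : ∀ k z, |avg ((Q ^ τ) ^ k) (fun z => 2 * (blockVar Q g τ z - V)) z|
      ≤ 256 * τ ^ 2 * (1 / 4) ^ k := by
    intro k z
    have e : avg ((Q ^ τ) ^ k) (fun z => 2 * (blockVar Q g τ z - V)) z
        = 2 * (avg (Q ^ (τ * k)) (blockVar Q g τ) z - ∫ z, blockVar Q g τ z ∂π) := by
      rw [pow_mul, hV]
      unfold avg
      rw [integral_const_mul, integral_sub (bH.integrable _) (integrable_const _)]
      simp
    have h := hQ.abs_avg_sub_le bH.1 hH (τ * k) z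
    rw [Nat.mul_div_cancel_left _ hQ.mixingTime_pos] at h
    rw [e, abs_mul, abs_two]
    linarith
  have hsum : HasSum (fun k : ℕ => 256 * (τ : ℝ) ^ 2 * (1 / 4) ^ k)
      (256 * (τ : ℝ) ^ 2 * (4 / 3)) := by
    have := (hasSum_geometric_of_lt_one (r := (1 / 4 : ℝ)) (by norm_num)
      (by norm_num)).mul_left (256 * (τ : ℝ) ^ 2)
    rwa [show ((1 : ℝ) - 1 / 4)⁻¹ = 4 / 3 by norm_num] at this
  have bu := bddMeas_potential bψ hsum hψ
  have hU := abs_potential_le hsum hψ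
  have hPu := potential_sub_avg bψ hsum hψ
  set t := |θ| * τ with ht
  have ht0 : 0 ≤ t := by positivity
  have ht1 : t ≤ 1 / 40 := by linarith
  have hθt : θ ^ 2 * (τ : ℝ) ^ 2 = t ^ 2 := by rw [ht, mul_pow, sq_abs]
  have ht2 : t ^ 2 ≤ 1 / 1600 := by nlinarith
  have key := integral_exp_le ξ bg.1 hG bu.1 hU hL hPu (θ := θ) (by nlinarith) m
  have e : ∀ ω, centeredSum π f (m * τ) ω
      = ∑ i ∈ Finset.range (m * τ), (g (ω i) - avg Q g (ω i)) := fun ω => by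
    simp only [hP]; rfl
  simp only [e]
  refine key.trans (Real.exp_le_exp.2 ?_)
  -- Here U = (1024/3)τ², so 8U² is about 932068 τ⁴.
  have h4 : (8 : ℝ) * θ ^ 4 * (256 * τ ^ 2 * (4 / 3)) ^ 2 ≤ 1000000 * τ * τ ^ 3 * θ ^ 4 := by
    have : 0 ≤ (τ : ℝ) ^ 4 * θ ^ 4 := by positivity
    nlinarith
  have h5 := mul_le_mul_of_nonneg_left h4 (Nat.cast_nonneg m : (0 : ℝ) ≤ m)
  have h6 : 2 * (|θ| * (8 / 3 * τ) + θ ^ 2 * (256 * τ ^ 2 * (4 / 3))) ≤ (1 : ℝ) := by nlinarith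
  have h7 : (m : ℝ) * (2 * θ ^ 2 * V) = 2 * (m * τ) * θ ^ 2 * asymptoticVariance Q π f := by
    simp only [V]; ring
  nlinarith

end Ergodic

end

/-! ### From exponential moments to p-th moments -/

section

/-- Apply y ≤ e^{y−1} to y = θ|x|/p and raise to the power p. -/
lemma abs_rpow_le_exp {p θ : ℝ} (hp : 0 < p) (hθ : 0 < θ) (x : ℝ) :
    |x| ^ p ≤ (p / θ * Real.exp (-1)) ^ p * (Real.exp (θ * x) + Real.exp (-θ * x)) := by
  have h1 : |x| ≤ p / θ * Real.exp (-1) * Real.exp (θ * |x| / p) := by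
    have h := Real.add_one_le_exp (θ * |x| / p - 1)
    rw [sub_add_cancel, sub_eq_add_neg, Real.exp_add] at h
    calc |x| = p / θ * (θ * |x| / p) := by field_simp
      _ ≤ p / θ * (Real.exp (θ * |x| / p) * Real.exp (-1)) :=
        mul_le_mul_of_nonneg_left h (by positivity)
      _ = _ := by ring
  have h2 : Real.exp (θ * |x|) ≤ Real.exp (θ * x) + Real.exp (-θ * x) := by
    rcases abs_cases x with ⟨h, _⟩ | ⟨h, _⟩ <;> rw [h]
    · linarith [Real.exp_pos (-θ * x)]
    · rw [mul_neg, ← neg_mul]; linarith [Real.exp_pos (θ * x)]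
  calc |x| ^ p ≤ (p / θ * Real.exp (-1) * Real.exp (θ * |x| / p)) ^ p :=
        Real.rpow_le_rpow (abs_nonneg _) h1 hp.le
    _ = (p / θ * Real.exp (-1)) ^ p * Real.exp (θ * |x|) := by
        rw [Real.mul_rpow (by positivity) (Real.exp_pos _).le, ← Real.exp_mul]
        congr 2
        field_simp
    _ ≤ _ := mul_le_mul_of_nonneg_left h2 (by positivity)

lemma constants_le :
    Real.exp 4 ≤ 55 ∧ 55 ≤ CRm1 * Real.sqrt 2 ∧ 32 * 55 ≤ D1 ∧ 1000000 ≤ D2 := by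
  have he := Real.exp_one_lt_d9
  have he' := Real.exp_one_gt_d9
  have hC : 163 ≤ CRm1 := by unfold CRm1; linarith
  have hs2 : 1 ≤ Real.sqrt 2 := Real.one_le_sqrt.2 (by norm_num)
  have hs19 : 5 / 2 ≤ Real.sqrt (19 / 3) := Real.le_sqrt_of_sq_le (by norm_num)
  have hs60 : 7 ≤ Real.sqrt 60 := Real.le_sqrt_of_sq_le (by norm_num)
  refine ⟨?_, ?_, ?_, ?_⟩
  · rw [show (4 : ℝ) = (4 : ℕ) * 1 by norm_num, Real.exp_nat_mul]
    calc Real.exp 1 ^ 4 ≤ 2.7182818286 ^ 4 := by gcongr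
      _ ≤ 55 := by norm_num
  · calc (55 : ℝ) ≤ 163 * 1 := by norm_num
      _ ≤ CRm1 * Real.sqrt 2 := by gcongr
  · unfold D1
    calc (32 * 55 : ℝ) ≤ 16 / 3 * (5 / 2) * 163 := by norm_num
      _ ≤ _ := by gcongr
  · unfold D2 CRm2
    calc (1000000 : ℝ) ≤ 64 / 3 * (7 * 163 ^ 2 + 60) := by norm_num
      _ ≤ _ := by gcongr

variable {Z : Type*} [mZ : MeasurableSpace Z]
variable {Q : Kernel Z Z} [IsMarkovKernel Q]
variable {π : Measure Z} [IsProbabilityMeasure π] {τ : ℕ} {f : Z → ℝ}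

omit [IsProbabilityMeasure π] in
lemma bddMeas_centeredSum (hf : Measurable f) (hf1 : ∀ z, |f z| ≤ 1) (n : ℕ) :
    BddMeas MeasurableSpace.pi (centeredSum π f n) :=
  BddMeas.sum _ fun i _ => (bddMeas_centered hf hf1).comp (measurable_pi_apply i)

lemma abs_centeredSum_sub_le (hf1 : ∀ z, |f z| ≤ 1) {m n : ℕ} (h : m ≤ n) (ω : ℕ → Z) :
    |centeredSum π f n ω - centeredSum π f m ω| ≤ 2 * (n - m : ℕ) := by
  unfold centeredSum
  rw [← Finset.sum_Ico_eq_sub _ h]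
  refine (Finset.abs_sum_le_sum_abs _ _).trans ?_
  have := Finset.sum_le_card_nsmul (Finset.Ico m n) (fun i => |centered π f (ω i)|) 2
    (fun i _ => abs_centered_le hf1 _)
  rw [Nat.card_Ico, nsmul_eq_mul] at this
  linarith

lemma BddMeas.abs_rpow {X : Type*} {m : MeasurableSpace X} {φ : X → ℝ} (h : BddMeas m φ)
    {p : ℝ} (hp : 0 ≤ p) : BddMeas m (fun x => |φ x| ^ p) := by
  obtain ⟨hm, C, hC⟩ := h
  refine ⟨by fun_prop, C ^ p, fun x => ?_⟩
  rw [abs_of_nonneg (Real.rpow_nonneg (abs_nonneg _) _)]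
  exact Real.rpow_le_rpow (abs_nonneg _) (hC x) hp

section Ergodic

variable (hQ : IsUniformlyGeometricallyErgodic Q π τ)
include hQ

/-- Fewer than τ terms lie outside the complete blocks; as 2τ|θ| ≤ 1 they cost at most a factor e.
-/
lemma integral_exp_centeredSum_le (ξ : Measure Z) [IsProbabilityMeasure ξ]
    (hf : Measurable f) (hf1 : ∀ z, |f z| ≤ 1) {θ : ℝ} (hθ : |θ| * (40 * τ) ≤ 1) (n : ℕ) :
    ∫ ω, Real.exp (θ * centeredSum π f n ω) ∂(chainLaw Q ξ)
      ≤ Real.exp (2 * n * θ ^ 2 * asymptoticVariance Q π f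
        + 1000000 * n * τ ^ 3 * θ ^ 4 + 2) := by
  have hmn : n / τ * τ ≤ n := Nat.div_mul_le_self n τ
  have hlt : n < n / τ * τ + τ := Nat.lt_div_mul_add hQ.mixingTime_pos
  have hmnR : ((n / τ : ℕ) : ℝ) * τ ≤ n := by exact_mod_cast hmn
  have hm := integral_exp_block_le hQ ξ hf hf1 hθ (n / τ)
  have hpt : ∀ ω, Real.exp (θ * centeredSum π f n ω)
      ≤ Real.exp 1 * Real.exp (θ * centeredSum π f (n / τ * τ) ω) := by
    intro ω
    rw [← Real.exp_add]
    refine Real.exp_le_exp.2 ?_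
    have h1 := abs_centeredSum_sub_le (π := π) hf1 hmn ω
    have h2 : ((n - n / τ * τ : ℕ) : ℝ) ≤ τ := by exact_mod_cast (by omega)
    have h3 : θ * (centeredSum π f n ω - centeredSum π f (n / τ * τ) ω) ≤ |θ| * (2 * τ) := by
      refine (le_abs_self _).trans ?_
      rw [abs_mul]
      exact mul_le_mul_of_nonneg_left (by linarith) (abs_nonneg _)
    linarith
  have hmono := integral_mono (μ := chainLaw Q ξ)
    (((bddMeas_centeredSum hf hf1 n).const_mul θ).exp.integrable _)
    ((((bddMeas_centeredSum hf hf1 (n / τ * τ)).const_mul θ).exp.const_mul _).integrable _) hpt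
  rw [integral_const_mul] at hmono
  refine hmono.trans ((mul_le_mul_of_nonneg_left hm (Real.exp_pos 1).le).trans ?_)
  rw [← Real.exp_add]
  refine Real.exp_le_exp.2 ?_
  have hσ := asymptoticVariance_nonneg hQ hf hf1
  have h1 : 2 * (((n / τ : ℕ) : ℝ) * τ) * θ ^ 2 * asymptoticVariance Q π f
      ≤ 2 * n * θ ^ 2 * asymptoticVariance Q π f := by gcongr
  have h2 : 1000000 * (((n / τ : ℕ) : ℝ) * τ) * τ ^ 3 * θ ^ 4
      ≤ 1000000 * n * τ ^ 3 * θ ^ 4 := by gcongr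
  linarith

/-- The scales a and b make the quadratic and quartic terms of the exponent O(p) once θa ≤ 1 and θb
≤ 1. Taking 1/θ = a + b + 40τ meets both and also 40τθ ≤ 1. -/
lemma momentNorm_le (ξ : Measure Z) [IsProbabilityMeasure ξ]
    (hf : Measurable f) (hf1 : ∀ z, |f z| ≤ 1) {p : ℝ} (hp : 2 ≤ p) (n : ℕ) {a b : ℝ}
    (ha : 0 ≤ a) (hb : 0 ≤ b) (ha' : n * asymptoticVariance Q π f ≤ p * a ^ 2)
    (hb' : 1000000 * n * τ ^ 3 ≤ p * b ^ 4) :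
    momentNorm Q ξ π f n p ≤ p * (a + b + 40 * τ) * Real.exp 4 := by
  have hτ : (0 : ℝ) < τ := by exact_mod_cast hQ.mixingTime_pos
  have hp0 : 0 < p := by linarith
  set s := a + b + 40 * τ with hs
  have hs0 : 0 < s := by positivity
  set θ := 1 / s with hθ
  have hθ0 : 0 < θ := by positivity
  have hθs : θ * s = 1 := by rw [hθ]; field_simp
  have hc : θ * (40 * τ) ≤ 1 := hθs ▸ mul_le_mul_of_nonneg_left (by linarith) hθ0.le
  have hθa : θ * a ≤ 1 := hθs ▸ mul_le_mul_of_nonneg_left (by rw [hs]; linarith) hθ0.le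
  have hθb : θ * b ≤ 1 := hθs ▸ mul_le_mul_of_nonneg_left (by rw [hs]; linarith) hθ0.le
  have hK : 2 * n * θ ^ 2 * asymptoticVariance Q π f + 1000000 * n * τ ^ 3 * θ ^ 4 ≤ 3 * p := by
    have h1 : θ ^ 2 * (n * asymptoticVariance Q π f) ≤ p := by
      calc _ ≤ θ ^ 2 * (p * a ^ 2) := by gcongr
        _ = p * (θ * a) ^ 2 := by ring
        _ ≤ p * 1 ^ 2 := by gcongr
        _ = p := by ring
    have h2 : θ ^ 4 * (1000000 * n * τ ^ 3) ≤ p := by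
      calc _ ≤ θ ^ 4 * (p * b ^ 4) := by gcongr
        _ = p * (θ * b) ^ 4 := by ring
        _ ≤ p * 1 ^ 4 := by gcongr
        _ = p := by ring
    linarith
  have he1 := integral_exp_centeredSum_le hQ ξ hf hf1 (θ := θ) (by rwa [abs_of_pos hθ0]) n
  have he2 := integral_exp_centeredSum_le hQ ξ hf hf1 (θ := -θ)
    (by rwa [abs_neg, abs_of_pos hθ0]) n
  rw [show (-θ) ^ 2 = θ ^ 2 by ring, show (-θ) ^ 4 = θ ^ 4 by ring] at he2
  have bS := bddMeas_centeredSum (π := π) hf hf1 n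
  have hint : ∫ ω, |centeredSum π f n ω| ^ p ∂(chainLaw Q ξ) ≤ (p * s * Real.exp 4) ^ p := by
    have hmono := integral_mono (μ := chainLaw Q ξ) ((bS.abs_rpow hp0.le).integrable _)
      ((((bS.const_mul θ).exp.add (bS.const_mul (-θ)).exp).const_mul
        ((p / θ * Real.exp (-1)) ^ p)).integrable _) (fun ω => abs_rpow_le_exp hp0 hθ0 _)
    rw [integral_const_mul, integral_add ((bS.const_mul θ).exp.integrable _)
      ((bS.const_mul (-θ)).exp.integrable _)] at hmono
    refine hmono.trans ?_
    have hsum : Real.exp (3 * p + 2) + Real.exp (3 * p + 2) ≤ Real.exp (5 * p) := by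
      have h1 : (2 : ℝ) ≤ Real.exp 1 := by have := Real.add_one_le_exp (1 : ℝ); linarith
      have h2 : Real.exp (3 * p + 2) + Real.exp (3 * p + 2) ≤ Real.exp (3 * p + 2) * Real.exp 1 := by
        nlinarith [Real.exp_pos (3 * p + 2)]
      rw [← Real.exp_add] at h2
      exact h2.trans (Real.exp_le_exp.2 (by linarith))
    have hexp : Real.exp (2 * n * θ ^ 2 * asymptoticVariance Q π f
        + 1000000 * n * τ ^ 3 * θ ^ 4 + 2) ≤ Real.exp (3 * p + 2) :=
      Real.exp_le_exp.2 (by linarith)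
    calc _ ≤ (p / θ * Real.exp (-1)) ^ p * Real.exp (5 * p) :=
          mul_le_mul_of_nonneg_left (by linarith) (by positivity)
      _ = (p * s * Real.exp 4) ^ p := by
          rw [Real.exp_mul, ← Real.mul_rpow (by positivity) (by positivity), mul_assoc (p / θ),
            ← Real.exp_add, hθ]
          norm_num
  unfold momentNorm
  calc _ ≤ ((p * s * Real.exp 4) ^ p) ^ (1 / p) := Real.rpow_le_rpow
        (integral_nonneg fun _ => Real.rpow_nonneg (abs_nonneg _) _) hint (by positivity)
    _ = _ := by
      rw [← Real.rpow_mul (by positivity), mul_one_div_cancel hp0.ne', Real.rpow_one]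

lemma momentNorm_le_rosenthal (ξ : Measure Z) [IsProbabilityMeasure ξ]
    (hf : Measurable f) (hf1 : ∀ z, |f z| ≤ 1) {p : ℝ} (hp : 2 ≤ p) (n : ℕ) :
    momentNorm Q ξ π f n p ≤
      CRm1 * Real.sqrt 2 * p ^ (1 / 2 : ℝ) * (n : ℝ) ^ (1 / 2 : ℝ) * asymptoticStd Q π f
        + D1 * (n : ℝ) ^ (1 / 4 : ℝ) * (τ : ℝ) ^ (3 / 4 : ℝ) * p * Real.logb 2 (2 * p)
        + D2 * τ * p * Real.logb 2 (2 * p) := by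
  have hp0 : 0 < p := by linarith
  have hn : (0 : ℝ) ≤ n := Nat.cast_nonneg n
  have hτ : (0 : ℝ) ≤ τ := Nat.cast_nonneg τ
  have hσ0 := asymptoticVariance_nonneg hQ hf hf1
  set σ := asymptoticStd Q π f with hσ
  have hσn : 0 ≤ σ := Real.sqrt_nonneg _
  have hσ2 : σ ^ 2 = asymptoticVariance Q π f := Real.sq_sqrt hσ0
  set x := p ^ (1 / 2 : ℝ) with hx
  set y := (n : ℝ) ^ (1 / 2 : ℝ) with hy
  set v := (n : ℝ) ^ (1 / 4 : ℝ) with hv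
  set w := (τ : ℝ) ^ (3 / 4 : ℝ) with hw
  set q := p ^ (1 / 4 : ℝ) with hq
  have hx0 : 0 < x := by positivity
  have hq0 : 0 < q := by positivity
  have hy0 : 0 ≤ y := by positivity
  have hv0 : 0 ≤ v := by positivity
  have hw0 : 0 ≤ w := by positivity
  have hx2 : x ^ 2 = p := by
    rw [hx, ← Real.rpow_natCast, ← Real.rpow_mul hp0.le]; norm_num
  have hy2 : y ^ 2 = n := by
    rw [hy, ← Real.rpow_natCast, ← Real.rpow_mul hn]; norm_num
  have hv4 : v ^ 4 = n := by
    rw [hv, ← Real.rpow_natCast, ← Real.rpow_mul hn]; norm_num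
  have hw4 : w ^ 4 = (τ : ℝ) ^ 3 := by
    rw [hw, ← Real.rpow_natCast, ← Real.rpow_mul hτ, ← Real.rpow_natCast]; norm_num
  have hq4 : q ^ 4 = p := by
    rw [hq, ← Real.rpow_natCast, ← Real.rpow_mul hp0.le]; norm_num
  have hq1 : 1 ≤ q := Real.one_le_rpow (by linarith) (by norm_num)
  -- a solves its constraint with equality; for b, 32⁴ = 1048576 exceeds 10⁶.
  have key := momentNorm_le hQ ξ hf hf1 hp n (a := y * σ / x) (b := 32 * v * w / q)
    (by positivity) (by positivity)
    (by rw [← hσ2, div_pow, mul_pow, hx2, hy2, mul_div_cancel₀ _ hp0.ne'])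
    (by
      rw [div_pow, mul_pow, mul_pow, hv4, hw4, hq4, mul_div_cancel₀ _ hp0.ne']
      have : 0 ≤ (n : ℝ) * τ ^ 3 := by positivity
      linarith)
  have hlog : 1 ≤ Real.logb 2 (2 * p) := by
    rw [Real.le_logb_iff_rpow_le (by norm_num) (by positivity)]
    norm_num
    linarith
  set l := Real.logb 2 (2 * p)
  obtain ⟨h4, hC, hD1, hD2⟩ := constants_le
  refine key.trans ?_
  have hsplit : p * (y * σ / x + 32 * v * w / q + 40 * τ) * Real.exp 4
      = Real.exp 4 * (x * y * σ) + Real.exp 4 * 32 * (v * w * (p / q))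
        + Real.exp 4 * 40 * (τ * p) := by
    rw [show y * σ / x = x * y * σ / p by rw [← hx2]; field_simp]
    field_simp
  rw [hsplit]
  have t1 : Real.exp 4 * (x * y * σ) ≤ CRm1 * Real.sqrt 2 * x * y * σ := by
    have : Real.exp 4 ≤ CRm1 * Real.sqrt 2 := by linarith
    have h := mul_le_mul_of_nonneg_right this (by positivity : 0 ≤ x * y * σ)
    linarith
  have t2 : Real.exp 4 * 32 * (v * w * (p / q)) ≤ D1 * v * w * p * l := by
    have h1 : p / q ≤ p * l := by
      rw [div_le_iff₀ hq0]
      rw [mul_assoc]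
      exact le_mul_of_one_le_right hp0.le (one_le_mul_of_one_le_of_one_le hlog hq1)
    calc _ ≤ D1 * (v * w * (p * l)) := by
          refine mul_le_mul (by linarith) (by gcongr) (by positivity) (by linarith)
      _ = _ := by ring
  have t3 : Real.exp 4 * 40 * (τ * p) ≤ D2 * τ * p * l := by
    calc _ ≤ D2 * (τ * (p * l)) := by
          refine mul_le_mul (by linarith) ?_ (by positivity) (by linarith)
          gcongr
          exact le_mul_of_one_le_right hp0.le hlog
      _ = _ := by ring
  linarith

end Ergodic

end

/-! ### Changing the initial distribution -/

section

lemma add_rpow_le_weighted {p l x y : ℝ} (hp : 1 ≤ p) (hl : 0 < l) (hl1 : l < 1) (hx : 0 ≤ x)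
    (hy : 0 ≤ y) : (x + y) ^ p ≤ l ^ (1 - p) * x ^ p + (1 - l) ^ (1 - p) * y ^ p := by
  have hl' : 0 < 1 - l := by linarith
  have h := (convexOn_rpow hp).2 (x := x / l) (y := y / (1 - l)) (Set.mem_Ici.2 (by positivity))
    (Set.mem_Ici.2 (by positivity)) hl.le hl'.le (by ring)
  simp only [smul_eq_mul] at h
  rw [mul_div_cancel₀ _ hl.ne', mul_div_cancel₀ _ hl'.ne', Real.div_rpow hx hl.le,
    Real.div_rpow hy hl'.le] at h
  rw [Real.rpow_sub hl, Real.rpow_sub hl', Real.rpow_one, Real.rpow_one]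
  refine h.trans_eq ?_
  ring

/-- Minkowski's inequality in a form linear in X and Y, hence stable under splitting measures. The
optimal weight is l = N/(N + b) with N = Y^{1/p}; the ε added to N keeps l positive when Y = 0. -/
lemma rpow_one_div_le_add {p X Y b : ℝ} (hp : 1 ≤ p) (hX : 0 ≤ X) (hY : 0 ≤ Y) (hb : 0 < b)
    (h : ∀ l : ℝ, 0 < l → l < 1 → X ≤ l ^ (1 - p) * Y + (1 - l) ^ (1 - p) * b ^ p) :
    X ^ (1 / p) ≤ Y ^ (1 / p) + b := by
  have hp0 : 0 < p := by linarith
  refine le_of_forall_pos_le_add fun ε hε => ?_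
  set N := Y ^ (1 / p) + ε with hN
  have hY' : 0 ≤ Y ^ (1 / p) := Real.rpow_nonneg hY _
  have hN0 : 0 < N := by positivity
  have hYN : Y ≤ N ^ p := by
    calc Y = (Y ^ (1 / p)) ^ p := by
          rw [← Real.rpow_mul hY, one_div_mul_cancel hp0.ne', Real.rpow_one]
      _ ≤ N ^ p := Real.rpow_le_rpow hY' (by linarith) hp0.le
  have hs : 0 < N + b := by positivity
  have hl1 : 1 - N / (N + b) = b / (N + b) := by field_simp; ring
  have e : ∀ t : ℝ, 0 < t → (t / (N + b)) ^ (1 - p) * t ^ p = t * (N + b) ^ (p - 1) := by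
    intro t ht
    rw [Real.div_rpow ht.le hs.le, div_mul_eq_mul_div, ← Real.rpow_add ht,
      show p - 1 = -(1 - p) by ring, Real.rpow_neg hs.le]
    simp [div_eq_mul_inv]
  have h1 : X ≤ (N + b) ^ p := by
    calc X ≤ (N / (N + b)) ^ (1 - p) * Y + (1 - N / (N + b)) ^ (1 - p) * b ^ p :=
          h _ (by positivity) (by rw [div_lt_one hs]; linarith)
      _ ≤ (N / (N + b)) ^ (1 - p) * N ^ p + (b / (N + b)) ^ (1 - p) * b ^ p := by
          rw [hl1]; gcongr
      _ = (N + b) * (N + b) ^ (p - 1) := by rw [e N hN0, e b hb]; ring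
      _ = (N + b) ^ p := by
          rw [Real.rpow_sub_one hs.ne']; field_simp
  calc X ^ (1 / p) ≤ ((N + b) ^ p) ^ (1 / p) := Real.rpow_le_rpow hX h1 (by positivity)
    _ = N + b := by rw [← Real.rpow_mul hs.le, mul_one_div_cancel hp0.ne', Real.rpow_one]
    _ = Y ^ (1 / p) + b + ε := by rw [hN]; ring

variable {Z : Type*} [mZ : MeasurableSpace Z]

section Value

/-- The conditional expectation of `φ (s + ∑_{i < n} h (Z_i))` given `Z_0 = z`, as a function of
`(s, z)`. -/
noncomputable def valueFn (Q : Kernel Z Z) (h : Z → ℝ) (φ : ℝ → ENNReal) : ℕ → ℝ × Z → ENNReal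
  | 0, x => φ x.1
  | n + 1, x => ∫⁻ y, valueFn Q h φ n (x.1 + h x.2, y) ∂(Q x.2)

variable (Q : Kernel Z Z) [IsMarkovKernel Q] {h : Z → ℝ} {φ ψ : ℝ → ENNReal}

lemma measurable_valueFn (hh : Measurable h) (hφ : Measurable φ) (n : ℕ) :
    Measurable (valueFn Q h φ n) := by
  induction n with
  | zero => exact hφ.comp measurable_fst
  | succ n ih =>
    have : Measurable fun x : (ℝ × Z) × Z => valueFn Q h φ n (x.1.1 + h x.1.2, x.2) := by fun_prop
    exact Measurable.lintegral_kernel_prod_right' (κ := Q.comap Prod.snd measurable_snd) this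

lemma lintegral_chainLaw_eq (ξ : Measure Z) [IsProbabilityMeasure ξ] (hh : Measurable h)
    (hφ : Measurable φ) (n : ℕ) :
    ∫⁻ ω, φ (∑ i ∈ Finset.range n, h (ω i)) ∂(chainLaw Q ξ)
      = ∫⁻ z, valueFn Q h φ n (0, z) ∂ξ := by
  -- The Markov property trades one step of the trajectory for one step of the recursion.
  have key : ∀ k m, ∫⁻ ω, valueFn Q h φ m (∑ i ∈ Finset.range k, h (ω i), ω k) ∂(chainLaw Q ξ)
      = ∫⁻ ω, valueFn Q h φ (m + k) (0, ω 0) ∂(chainLaw Q ξ) := by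
    intro k
    induction k with
    | zero => intro m; simp
    | succ k ih =>
      intro m
      have hS : Measurable[hist Z k] fun ω : ℕ → Z => ∑ i ∈ Finset.range (k + 1), h (ω i) :=
        Finset.measurable_sum _ fun i hi =>
          hh.comp (measurable_hist (Nat.lt_succ_iff.1 (Finset.mem_range.1 hi)))
      rw [lintegral_chainLaw_succ Q ξ k hS (measurable_valueFn Q hh hφ m)]
      have := ih (m + 1)
      rw [show m + (k + 1) = m + 1 + k by ring, ← this]
      simp only [valueFn, Finset.sum_range_succ]
  have h1 := key n 0
  rw [zero_add] at h1
  have hm : Measurable fun z => valueFn Q h φ n (0, z) :=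
    (measurable_valueFn Q hh hφ n).comp measurable_prodMk_left
  calc _ = ∫⁻ ω, valueFn Q h φ n (0, ω 0) ∂(chainLaw Q ξ) := h1
    _ = ∫⁻ z, valueFn Q h φ n (0, z) ∂((chainLaw Q ξ).map fun ω => ω 0) :=
        (lintegral_map hm (measurable_pi_apply 0)).symm
    _ = _ := by rw [map_chainLaw_zero]

omit [IsMarkovKernel Q] in
lemma valueFn_shift_le {a : ℝ} (H : ∀ s, φ (s + a) ≤ ψ s) (n : ℕ) (s : ℝ) (z : Z) :
    valueFn Q h φ n (s + a, z) ≤ valueFn Q h ψ n (s, z) := by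
  induction n generalizing s z with
  | zero => exact H s
  | succ n ih =>
    refine lintegral_mono fun y => ?_
    rw [show s + a + h z = s + h z + a by ring]
    exact ih _ _

omit [IsMarkovKernel Q] in
lemma le_valueFn_shift {a : ℝ} (H : ∀ s, φ s ≤ ψ (s + a)) (n : ℕ) (s : ℝ) (z : Z) :
    valueFn Q h φ n (s, z) ≤ valueFn Q h ψ n (s + a, z) := by
  have := valueFn_shift_le Q (h := h) (φ := φ) (ψ := ψ) (a := -a)
    (fun s => by simpa using H (s + -a)) n (s + a) z
  simpa using this

lemma valueFn_le_add (hh : Measurable h) (hψ : Measurable ψ) {L K : ENNReal}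
    (H : ∀ s, φ s ≤ L * ψ s + K) (n : ℕ) (x : ℝ × Z) :
    valueFn Q h φ n x ≤ L * valueFn Q h ψ n x + K := by
  induction n generalizing x with
  | zero => exact H x.1
  | succ n ih =>
    have hm : Measurable fun y => valueFn Q h ψ n (x.1 + h x.2, y) :=
      (measurable_valueFn Q hh hψ n).comp measurable_prodMk_left
    refine (lintegral_mono fun y => ih _).trans_eq ?_
    rw [lintegral_add_right _ measurable_const, lintegral_const_mul _ hm, lintegral_const,
      measure_univ, mul_one]
    rfl

omit [IsMarkovKernel Q] in
lemma bind_pow_succ (μ : Measure Z) (j : ℕ) :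
    (Q ^ (j + 1)) ∘ₘ μ = (Q ^ j) ∘ₘ (Q ∘ₘ μ) := by
  rw [pow_succ, Measure.comp_assoc]
  rfl

/-- Forgetting the first j summands, each of size at most 2, costs 2j in the parameter c; the chain
then restarts from its law at time j. -/
lemma lintegral_valueFn_le (hh : Measurable h) (hb : ∀ z, |h z| ≤ 2) {Φ : ℝ → ℝ → ENNReal}
    (hΦ : ∀ c, Measurable (Φ c)) (H : ∀ c s a, |a| ≤ 2 → Φ c (s + a) ≤ Φ (c + 2) s)
    (m j : ℕ) (c : ℝ) (μ : Measure Z) :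
    ∫⁻ z, valueFn Q h (Φ c) (m + j) (0, z) ∂μ
      ≤ ∫⁻ z, valueFn Q h (Φ (c + 2 * j)) m (0, z) ∂((Q ^ j) ∘ₘ μ) := by
  induction j generalizing c μ with
  | zero =>
    have : (Q ^ 0 : Kernel Z Z) ∘ₘ μ = μ := by rw [pow_zero]; exact Measure.bind_dirac
    rw [this]
    simp
  | succ j ih =>
    have hm : Measurable fun z => valueFn Q h (Φ (c + 2)) (m + j) (0, z) :=
      (measurable_valueFn Q hh (hΦ _) _).comp measurable_prodMk_left
    rw [bind_pow_succ, show c + 2 * ((j + 1 : ℕ) : ℝ) = c + 2 + 2 * j by push_cast; ring]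
    refine le_trans ?_ (ih (c + 2) (Q ∘ₘ μ))
    rw [Measure.lintegral_bind Q.aemeasurable hm.aemeasurable]
    refine lintegral_mono fun z => lintegral_mono fun y => ?_
    exact valueFn_shift_le Q (fun s => H c s _ (hb z)) _ _ _

lemma le_lintegral_valueFn (hh : Measurable h) (hb : ∀ z, |h z| ≤ 2) {Φ : ℝ → ℝ → ENNReal}
    (hΦ : ∀ c, Measurable (Φ c)) (H : ∀ c s a, |a| ≤ 2 → Φ (c + 2) s ≤ Φ c (s + a))
    (m j : ℕ) (c : ℝ) (μ : Measure Z) :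
    ∫⁻ z, valueFn Q h (Φ (c + 2 * j)) m (0, z) ∂((Q ^ j) ∘ₘ μ)
      ≤ ∫⁻ z, valueFn Q h (Φ c) (m + j) (0, z) ∂μ := by
  induction j generalizing c μ with
  | zero =>
    have : (Q ^ 0 : Kernel Z Z) ∘ₘ μ = μ := by rw [pow_zero]; exact Measure.bind_dirac
    rw [this]
    simp
  | succ j ih =>
    have hm : Measurable fun z => valueFn Q h (Φ (c + 2)) (m + j) (0, z) :=
      (measurable_valueFn Q hh (hΦ _) _).comp measurable_prodMk_left
    rw [bind_pow_succ, show c + 2 * ((j + 1 : ℕ) : ℝ) = c + 2 + 2 * j by push_cast; ring]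
    refine (ih (c + 2) (Q ∘ₘ μ)).trans ?_
    rw [Measure.lintegral_bind Q.aemeasurable hm.aemeasurable]
    refine lintegral_mono fun z => lintegral_mono fun y => ?_
    exact le_valueFn_shift Q (fun s => H c s _ (hb z)) _ _ _

end Value

/-- Two finite measures split into a common part and excess parts. -/
lemma exists_common_part (μ ν : Measure Z) [IsFiniteMeasure μ] [IsFiniteMeasure ν] :
    ∃ (α e e' : Measure Z) (A : Set Z), IsFiniteMeasure α ∧ IsFiniteMeasure e ∧
      IsFiniteMeasure e' ∧ MeasurableSet A ∧ μ = α + e ∧ ν = α + e' ∧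
      e Set.univ + ν A = μ A := by
  obtain ⟨A, hA, h1, h2⟩ := hahn_decomposition μ ν
  have hle : ν.restrict A ≤ μ.restrict A := Measure.le_iff.2 fun t ht => by
    rw [Measure.restrict_apply ht, Measure.restrict_apply ht]
    exact h1 _ (ht.inter hA) Set.inter_subset_right
  have hle' : μ.restrict Aᶜ ≤ ν.restrict Aᶜ := Measure.le_iff.2 fun t ht => by
    rw [Measure.restrict_apply ht, Measure.restrict_apply ht]
    exact h2 _ (ht.inter hA.compl) Set.inter_subset_right
  have s1 := Measure.sub_add_cancel_of_le hle
  have s2 := Measure.sub_add_cancel_of_le hle'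
  refine ⟨ν.restrict A + μ.restrict Aᶜ, μ.restrict A - ν.restrict A,
    ν.restrict Aᶜ - μ.restrict Aᶜ, A, inferInstance, inferInstance, inferInstance, hA, ?_, ?_, ?_⟩
  · rw [add_comm, ← add_assoc, s1, Measure.restrict_add_restrict_compl hA]
  · rw [add_assoc, add_comm (μ.restrict Aᶜ), s2, Measure.restrict_add_restrict_compl hA]
  · have := congrArg (fun m => m Set.univ) s1
    simpa using this

variable {Q : Kernel Z Z} [IsMarkovKernel Q] {π : Measure Z} [IsProbabilityMeasure π] {τ : ℕ}

/-- After 2τ steps every starting point gives A its stationary probability up to 2(1/4)² = 1/8, so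
two starting points differ by at most 1/4. -/
lemma comp_apply_le (hQ : IsUniformlyGeometricallyErgodic Q π τ) {μ ν : Measure Z}
    [IsFiniteMeasure μ] [IsFiniteMeasure ν] (hμν : μ Set.univ = ν Set.univ) {A : Set Z}
    (hA : MeasurableSet A) :
    ((Q ^ (2 * τ)) ∘ₘ μ) A ≤ ((Q ^ (2 * τ)) ∘ₘ ν) A + ENNReal.ofReal (1 / 4) * μ Set.univ := by
  have hz : ∀ z, |((Q ^ (2 * τ)) z).real A - π.real A| ≤ 1 / 8 := by
    intro z
    have h := hQ.abs_avg_sub_le (φ := A.indicator 1) (B := 1)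
      (measurable_one.indicator hA) (fun z => by
        by_cases h : z ∈ A <;> simp [h]) (2 * τ) z
    rw [Nat.mul_div_cancel _ hQ.mixingTime_pos] at h
    unfold avg at h
    rw [integral_indicator_one hA, integral_indicator_one hA] at h
    norm_num at h ⊢
    exact h
  have hup : ∀ z, (Q ^ (2 * τ)) z A ≤ ENNReal.ofReal (π.real A + 1 / 8) := fun z => by
    rw [← ofReal_measureReal (μ := (Q ^ (2 * τ)) z)]
    exact ENNReal.ofReal_le_ofReal (by linarith [(abs_le.1 (hz z)).2])
  have hlo : ∀ z, ENNReal.ofReal (π.real A - 1 / 8) ≤ (Q ^ (2 * τ)) z A := fun z => by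
    rw [← ofReal_measureReal (μ := (Q ^ (2 * τ)) z)]
    exact ENNReal.ofReal_le_ofReal (by linarith [(abs_le.1 (hz z)).1])
  rw [Measure.bind_apply hA (Kernel.aemeasurable _), Measure.bind_apply hA (Kernel.aemeasurable _)]
  calc ∫⁻ z, (Q ^ (2 * τ)) z A ∂μ ≤ ENNReal.ofReal (π.real A + 1 / 8) * μ Set.univ := by
        rw [← lintegral_const]; exact lintegral_mono hup
    _ ≤ (ENNReal.ofReal (π.real A - 1 / 8) + ENNReal.ofReal (1 / 4)) * μ Set.univ := by
        gcongr
        refine le_trans (ENNReal.ofReal_le_ofReal ?_) ENNReal.ofReal_add_le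
        linarith
    _ = ENNReal.ofReal (π.real A - 1 / 8) * ν Set.univ + ENNReal.ofReal (1 / 4) * μ Set.univ := by
        rw [add_mul, ← hμν]
    _ ≤ _ := by
        gcongr
        rw [← lintegral_const]; exact lintegral_mono hlo

/-- With q = 2c + 16τp, adding 8τ multiplies q by at most 1 + 1/(2p), hence q^p by at most √e < 2.
The left side is thus at most q^p + 2q^p. This closes the recursion below. -/
lemma rate_step {p τ c : ℝ} (hp : 2 ≤ p) (hτ : 0 < τ) (hc : 0 ≤ c) :
    (2 * (c + 4 * τ)) ^ p + 1 / 4 * (4 * (2 * (c + 4 * τ) + 16 * τ * p) ^ p)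
      ≤ 4 * (2 * c + 16 * τ * p) ^ p := by
  have hp0 : 0 < p := by linarith
  have hq : 0 < 2 * c + 16 * τ * p := by positivity
  have h1 : (2 * (c + 4 * τ)) ^ p ≤ (2 * c + 16 * τ * p) ^ p :=
    Real.rpow_le_rpow (by positivity) (by nlinarith) hp0.le
  have h2 : (2 * (c + 4 * τ) + 16 * τ * p) ^ p ≤ 2 * (2 * c + 16 * τ * p) ^ p := by
    have h3 : 2 * (c + 4 * τ) + 16 * τ * p ≤ (2 * c + 16 * τ * p) * Real.exp (1 / (2 * p)) := by
      have h4 := Real.add_one_le_exp (1 / (2 * p))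
      have h5 : 8 * τ ≤ (2 * c + 16 * τ * p) * (1 / (2 * p)) := by
        rw [mul_one_div, le_div_iff₀ (by positivity)]
        nlinarith
      nlinarith [mul_le_mul_of_nonneg_left h4 hq.le]
    calc _ ≤ ((2 * c + 16 * τ * p) * Real.exp (1 / (2 * p))) ^ p :=
          Real.rpow_le_rpow (by positivity) h3 hp0.le
      _ = (2 * c + 16 * τ * p) ^ p * Real.exp (1 / 2) := by
          rw [Real.mul_rpow hq.le (Real.exp_pos _).le, ← Real.exp_mul]
          congr 2
          field_simp
      _ ≤ (2 * c + 16 * τ * p) ^ p * 2 := by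
          gcongr
          have h6 := Real.exp_one_lt_d9
          have h7 : Real.exp (1 / 2) ^ 2 = Real.exp 1 := by
            rw [← Real.exp_nat_mul]; norm_num
          nlinarith [Real.exp_pos (1 / 2)]
      _ = _ := mul_comm _ _
  have h8 := Real.rpow_nonneg hq.le p
  linarith

/-- `((|s| + c)⁺) ^ p`. -/
noncomputable def upperPow (p c s : ℝ) : ENNReal := ENNReal.ofReal (max (|s| + c) 0 ^ p)

/-- `((|s| - c)⁺) ^ p`. -/
noncomputable def lowerPow (p c s : ℝ) : ENNReal := ENNReal.ofReal (max (|s| - c) 0 ^ p)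

lemma measurable_upperPow (p c : ℝ) : Measurable (upperPow p c) := by
  unfold upperPow; fun_prop

lemma measurable_lowerPow (p c : ℝ) : Measurable (lowerPow p c) := by
  unfold lowerPow; fun_prop

lemma lowerPow_shift {p : ℝ} (hp : 0 ≤ p) (c s a : ℝ) (ha : |a| ≤ 2) :
    lowerPow p (c + 2) s ≤ lowerPow p c (s + a) := by
  refine ENNReal.ofReal_le_ofReal (Real.rpow_le_rpow (le_max_right _ _) ?_ hp)
  refine max_le_max ?_ le_rfl
  have := abs_sub_abs_le_abs_sub s (-a)
  rw [abs_neg, sub_neg_eq_add] at this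
  linarith

/-- |s| + c ≤ (|s| − c)⁺ + 2c, followed by weighted convexity. -/
lemma upperPow_le {p l c : ℝ} (hp : 1 ≤ p) (hl : 0 < l) (hl1 : l < 1) (hc : 0 ≤ c) (s : ℝ) :
    upperPow p c s ≤ ENNReal.ofReal (l ^ (1 - p)) * lowerPow p c s
      + ENNReal.ofReal ((1 - l) ^ (1 - p)) * ENNReal.ofReal ((2 * c) ^ p) := by
  have hl' : 0 < 1 - l := by linarith
  unfold upperPow lowerPow
  rw [← ENNReal.ofReal_mul (by positivity), ← ENNReal.ofReal_mul (by positivity),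
    ← ENNReal.ofReal_add (by positivity) (by positivity)]
  refine ENNReal.ofReal_le_ofReal (le_trans ?_
    (add_rpow_le_weighted hp hl hl1 (le_max_right (|s| - c) 0) (by positivity : 0 ≤ 2 * c)))
  refine Real.rpow_le_rpow (le_max_right _ _) (max_le ?_ (by positivity)) (by linarith)
  linarith [le_max_left (|s| - c) 0]

lemma upperPow_shift {p : ℝ} (hp : 0 ≤ p) (c s a : ℝ) (ha : |a| ≤ 2) :
    upperPow p c (s + a) ≤ upperPow p (c + 2) s := by
  refine ENNReal.ofReal_le_ofReal (Real.rpow_le_rpow (le_max_right _ _) ?_ hp)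
  refine max_le_max ?_ le_rfl
  linarith [abs_add_le s a]

/-- The parameter c records how far the forgotten summands may have moved either sum. Finite
measures of equal mass are allowed so that the induction applies to the excess parts. -/
lemma lintegral_valueFn_upperPow_le (hQ : IsUniformlyGeometricallyErgodic Q π τ) {h : Z → ℝ}
    (hh : Measurable h) (hb : ∀ z, |h z| ≤ 2) {p l : ℝ} (hp : 2 ≤ p) (hl : 0 < l) (hl1 : l < 1)
    (n : ℕ) {c : ℝ} (hc : 0 ≤ c) (μ ν : Measure Z) [IsFiniteMeasure μ] [IsFiniteMeasure ν]
    (hμν : μ Set.univ = ν Set.univ) :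
    ∫⁻ z, valueFn Q h (upperPow p c) n (0, z) ∂μ
      ≤ ENNReal.ofReal (l ^ (1 - p)) * ∫⁻ z, valueFn Q h (lowerPow p c) n (0, z) ∂ν
        + ENNReal.ofReal ((1 - l) ^ (1 - p)) *
          (ENNReal.ofReal (4 * (2 * c + 16 * τ * p) ^ p) * μ Set.univ) := by
  have hτ : (0 : ℝ) < τ := by exact_mod_cast hQ.mixingTime_pos
  have hp0 : 0 < p := by linarith
  have hl' : 0 < 1 - l := by linarith
  induction n using Nat.strong_induction_on generalizing c μ ν with
  | _ n ih =>
  rcases lt_or_ge n (2 * τ) with hn | hn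
  -- Too short for a block: the whole sum is at most 4τ, and the error term alone suffices because
  -- (1 − l)^{1−p} ≥ 1.
  · have hn' : (n : ℝ) ≤ 2 * τ := by exact_mod_cast hn.le
    have h1 := lintegral_valueFn_le Q hh hb (measurable_upperPow p) (upperPow_shift hp0.le) 0 n c μ
    rw [zero_add] at h1
    refine h1.trans (le_trans ?_ le_add_self)
    simp only [valueFn]
    rw [lintegral_const, Measure.bind_apply MeasurableSet.univ (Kernel.aemeasurable _)]
    simp only [measure_univ, lintegral_one]
    rw [← mul_assoc]
    gcongr
    rw [← ENNReal.ofReal_mul (by positivity), upperPow]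
    refine ENNReal.ofReal_le_ofReal ?_
    have h2 : (1 : ℝ) ≤ (1 - l) ^ (1 - p) :=
      Real.one_le_rpow_of_pos_of_le_one_of_nonpos hl' (by linarith) (by linarith)
    have h3 : max (|(0 : ℝ)| + (c + 2 * n)) 0 ^ p ≤ (2 * c + 16 * τ * p) ^ p := by
      refine Real.rpow_le_rpow (le_max_right _ _) (max_le ?_ (by positivity)) hp0.le
      rw [abs_zero]
      nlinarith
    have h4 : 0 ≤ (2 * c + 16 * τ * p) ^ p := by positivity
    nlinarith
  · obtain ⟨m, rfl⟩ := Nat.exists_eq_add_of_le' hn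
    set c' := c + 4 * (τ : ℝ) with hc'
    have hcc : c + 2 * ((2 * τ : ℕ) : ℝ) = c' := by rw [hc']; push_cast; ring
    have hup := lintegral_valueFn_le Q hh hb (measurable_upperPow p) (upperPow_shift hp0.le)
      m (2 * τ) c μ
    have hlow := le_lintegral_valueFn Q hh hb (measurable_lowerPow p) (lowerPow_shift hp0.le)
      m (2 * τ) c ν
    rw [hcc] at hup hlow
    have hfin : ∀ ρ : Measure Z, ((Q ^ (2 * τ)) ∘ₘ ρ) Set.univ = ρ Set.univ := fun ρ => by
      rw [Measure.bind_apply MeasurableSet.univ (Kernel.aemeasurable _)]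
      simp
    have : IsFiniteMeasure ((Q ^ (2 * τ)) ∘ₘ μ) := ⟨by rw [hfin]; exact measure_lt_top _ _⟩
    have : IsFiniteMeasure ((Q ^ (2 * τ)) ∘ₘ ν) := ⟨by rw [hfin]; exact measure_lt_top _ _⟩
    obtain ⟨α, e, e', A, hα, he, he', hA, hμe, hνe, hex⟩ :=
      exists_common_part ((Q ^ (2 * τ) : Kernel Z Z) ∘ₘ μ) ((Q ^ (2 * τ) : Kernel Z Z) ∘ₘ ν)
    have hcomp := comp_apply_le hQ hμν hA
    have hμm : μ Set.univ = α Set.univ + e Set.univ := by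
      rw [← hfin μ, hμe, Measure.add_apply]
    have hνm : ν Set.univ = α Set.univ + e' Set.univ := by
      rw [← hfin ν, hνe, Measure.add_apply]
    have hee : e Set.univ = e' Set.univ := by
      rw [hμm, hνm] at hμν
      exact (ENNReal.add_right_inj (measure_ne_top α _)).1 hμν
    -- The excess mass is the difference of the two laws on the Hahn set A, which `comp_apply_le`
    -- controls.
    have hem : e Set.univ ≤ ENNReal.ofReal (1 / 4) * μ Set.univ := by
      rw [← hex, add_comm] at hcomp
      exact (ENNReal.add_le_add_iff_left (measure_ne_top _ A)).1 hcomp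
    have hαm : α Set.univ ≤ μ Set.univ := by rw [hμm]; exact le_self_add
    have hih := ih m (by have := hQ.mixingTime_pos; omega) (c := c') (by positivity) e e' hee
    have hpt := fun z : Z => valueFn_le_add Q hh (measurable_lowerPow p c')
      (upperPow_le (c := c') (by linarith : 1 ≤ p) hl hl1 (by positivity)) m (0, z)
    have hmeas : Measurable fun z => valueFn Q h (lowerPow p c') m (0, z) :=
      (measurable_valueFn Q hh (measurable_lowerPow p c') m).comp measurable_prodMk_left
    set L := ENNReal.ofReal (l ^ (1 - p))
    set K := ENNReal.ofReal ((1 - l) ^ (1 - p))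
    set M := μ Set.univ
    have hαI : ∫⁻ z, valueFn Q h (upperPow p c') m (0, z) ∂α
        ≤ L * ∫⁻ z, valueFn Q h (lowerPow p c') m (0, z) ∂α
          + K * ENNReal.ofReal ((2 * c') ^ p) * M := by
      refine (lintegral_mono hpt).trans ?_
      rw [lintegral_add_right _ measurable_const, lintegral_const_mul _ hmeas, lintegral_const]
      gcongr
    have hrate : ENNReal.ofReal ((2 * c') ^ p)
        + ENNReal.ofReal (1 / 4) * ENNReal.ofReal (4 * (2 * c' + 16 * τ * p) ^ p)
        ≤ ENNReal.ofReal (4 * (2 * c + 16 * τ * p) ^ p) := by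
      rw [← ENNReal.ofReal_mul (by positivity), ← ENNReal.ofReal_add (by positivity)
        (by positivity)]
      exact ENNReal.ofReal_le_ofReal (rate_step hp hτ hc)
    set B := ENNReal.ofReal (4 * (2 * c' + 16 * τ * p) ^ p)
    calc _ ≤ ∫⁻ z, valueFn Q h (upperPow p c') m (0, z) ∂α
          + ∫⁻ z, valueFn Q h (upperPow p c') m (0, z) ∂e := by
          rw [← lintegral_add_measure, ← hμe]; exact hup
      _ ≤ (L * ∫⁻ z, valueFn Q h (lowerPow p c') m (0, z) ∂α
          + K * ENNReal.ofReal ((2 * c') ^ p) * M)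
          + (L * ∫⁻ z, valueFn Q h (lowerPow p c') m (0, z) ∂e'
          + K * (B * (ENNReal.ofReal (1 / 4) * M))) := by
          refine add_le_add hαI (hih.trans ?_)
          gcongr
      _ = L * (∫⁻ z, valueFn Q h (lowerPow p c') m (0, z) ∂α
          + ∫⁻ z, valueFn Q h (lowerPow p c') m (0, z) ∂e')
          + K * ((ENNReal.ofReal ((2 * c') ^ p) + ENNReal.ofReal (1 / 4) * B) * M) := by ring
      _ ≤ _ := by
          rw [← lintegral_add_measure, ← hνe]
          gcongr

lemma momentNorm_le_add (hQ : IsUniformlyGeometricallyErgodic Q π τ) {f : Z → ℝ}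
    (hf : Measurable f) (hf1 : ∀ z, |f z| ≤ 1) {p : ℝ} (hp : 2 ≤ p) (n : ℕ)
    (ξ : Measure Z) [IsProbabilityMeasure ξ] :
    momentNorm Q ξ π f n p ≤ momentNorm Q π π f n p + 64 * τ * p := by
  have hτ : (0 : ℝ) < τ := by exact_mod_cast hQ.mixingTime_pos
  have hp0 : 0 < p := by linarith
  have hnn : ∀ ω, 0 ≤ |centeredSum π f n ω| ^ p := fun ω => by positivity
  refine rpow_one_div_le_add (by linarith) (integral_nonneg hnn) (integral_nonneg hnn)
    (by positivity) fun l hl hl1 => ?_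
  have hl' : 0 < 1 - l := by linarith
  have hc := bddMeas_centered (π := π) hf hf1
  have bS := (bddMeas_centeredSum (π := π) hf hf1 n).abs_rpow hp0.le
  have key := lintegral_valueFn_upperPow_le hQ hc.1 (abs_centered_le hf1) hp hl hl1 n le_rfl ξ π
    (by simp)
  rw [← lintegral_chainLaw_eq Q ξ hc.1 (measurable_upperPow p 0),
    ← lintegral_chainLaw_eq Q π hc.1 (measurable_lowerPow p 0)] at key
  have eu : ∀ ω : ℕ → Z, upperPow p 0 (∑ i ∈ Finset.range n, centered π f (ω i))
      = ENNReal.ofReal (|centeredSum π f n ω| ^ p) := fun ω => by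
    rw [upperPow, add_zero, max_eq_left (abs_nonneg _)]; rfl
  have el : ∀ ω : ℕ → Z, lowerPow p 0 (∑ i ∈ Finset.range n, centered π f (ω i))
      = ENNReal.ofReal (|centeredSum π f n ω| ^ p) := fun ω => by
    rw [lowerPow, sub_zero, max_eq_left (abs_nonneg _)]; rfl
  simp only [eu, el, measure_univ, mul_one, mul_zero, zero_add] at key
  rw [← ofReal_integral_eq_lintegral_ofReal (bS.integrable _) (Filter.Eventually.of_forall hnn),
    ← ofReal_integral_eq_lintegral_ofReal (bS.integrable _) (Filter.Eventually.of_forall hnn),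
    ← ENNReal.ofReal_mul (by positivity), ← ENNReal.ofReal_mul (by positivity),
    ← ENNReal.ofReal_add (mul_nonneg (by positivity) (integral_nonneg hnn)) (by positivity),
    ENNReal.ofReal_le_ofReal_iff (add_nonneg (mul_nonneg (by positivity) (integral_nonneg hnn))
      (by positivity))] at key
  refine key.trans ?_
  gcongr
  -- Absorbing the factor 4 into the p-th power yields 64 = 4 · 16.
  calc 4 * (16 * τ * p) ^ p ≤ 4 ^ p * (16 * τ * p) ^ p := by
        gcongr
        calc (4 : ℝ) = 4 ^ (1 : ℝ) := (Real.rpow_one 4).symm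
          _ ≤ 4 ^ p := Real.rpow_le_rpow_of_exponent_le (by norm_num) (by linarith)
    _ = (64 * τ * p) ^ p := by
        rw [← Real.mul_rpow (by norm_num) (by positivity)]
        congr 1
        ring

end

end MarkovRosenthal

theorem theorem1 {Z : Type*} [MetricSpace Z] [CompleteSpace Z]
    [TopologicalSpace.SeparableSpace Z] [MeasurableSpace Z] [BorelSpace Z]
    (Q : Kernel Z Z) [IsMarkovKernel Q] (π : Measure Z) [IsProbabilityMeasure π] (τ : ℕ)
    (hQ : MarkovRosenthal.IsUniformlyGeometricallyErgodic Q π τ)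
    (f : Z → ℝ) (hf : Measurable f) (hf_bound : ∀ z, |f z| ≤ 1)
    (p : ℝ) (hp : 2 ≤ p) (n : ℕ) :
    -- the asymptotic variance is well defined: its series converges and it is nonnegative
    (Summable (fun l : ℕ => MarkovRosenthal.autocov Q π f (l + 1)) ∧
      0 ≤ MarkovRosenthal.asymptoticVariance Q π f) ∧
    -- the stationary bound
    MarkovRosenthal.momentNorm Q π π f n p ≤
      MarkovRosenthal.CRm1 * Real.sqrt 2 * p ^ (1 / 2 : ℝ) * (n : ℝ) ^ (1 / 2 : ℝ) *
          MarkovRosenthal.asymptoticStd Q π f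
        + MarkovRosenthal.D1 * (n : ℝ) ^ (1 / 4 : ℝ) * (τ : ℝ) ^ (3 / 4 : ℝ) * p *
          Real.logb 2 (2 * p)
        + MarkovRosenthal.D2 * τ * p * Real.logb 2 (2 * p) ∧
    -- the bound for an arbitrary initial distribution
    ∀ (ξ : Measure Z) [IsProbabilityMeasure ξ],
      MarkovRosenthal.momentNorm Q ξ π f n p ≤
        MarkovRosenthal.momentNorm Q π π f n p
          + 2 * MarkovRosenthal.D2 * τ * p * Real.logb 2 (2 * p) := by
  have hp0 : 0 < p := by linarith
  refine ⟨⟨?_, MarkovRosenthal.asymptoticVariance_nonneg hQ hf hf_bound⟩,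
    MarkovRosenthal.momentNorm_le_rosenthal hQ π hf hf_bound hp n, fun ξ _ => ?_⟩
  · exact (summable_nat_add_iff 1).2 (MarkovRosenthal.summable_autocov hQ hf hf_bound)
  · refine (MarkovRosenthal.momentNorm_le_add hQ hf hf_bound hp n ξ).trans ?_
    have hD := MarkovRosenthal.constants_le.2.2.2
    have hlog : 1 ≤ Real.logb 2 (2 * p) := by
      rw [Real.le_logb_iff_rpow_le (by norm_num) (by positivity)]
      norm_num
      linarith
    have hτ : (0 : ℝ) ≤ τ := Nat.cast_nonneg τ
    refine add_le_add le_rfl ?_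
    calc 64 * (τ : ℝ) * p = 64 * τ * p * 1 := by ring
      _ ≤ 2 * MarkovRosenthal.D2 * τ * p * Real.logb 2 (2 * p) := by
        gcongr
        linarith
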